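/- Let $n \ge 0$, $q\ge 1$ and $p \ge 0$ be integers, let $\mathbf X\in\mathbb R^{p\times n}$ be a design matrix, $\mathbf Y\in\mathbb R^{q\times n}$ an observed response matrix and $\epsilon>0$. For a model $M\subseteq\{1,\dots,p\}$ let $\mathbf X_M\in\mathbb R^{|M|\times n}$ consist of the rows of $\mathbf X$ with index in $M$, and put $$\mathbf H_M=\mathbf X_M^\top(\mathbf X_M\mathbf X_M^\top)^{-1}\mathbf X_M,\quad \widehat{\mathbf B}_M=\mathbf Y\mathbf X_M^\top(\mathbf X_M\mathbf X_M^\top)^{-1},\quad \widehat{\boldsymbol\Sigma}_M=\mathbf Y(\mathbf I_n-\mathbf H_M)\mathbf Y^\top .$$ The data generating equation of the model $M$ is $\mathbf Y=G(\mathbf U,(\mathbf B,\mathbf A))=\mathbf B\mathbf X_M+\mathbf A\mathbf U$ with parameters $\mathbf B\in\mathbb R^{q\times|M|}$, $\mathbf A\in\mathbb R^{q\times q}$ and a $q\times n$ matrix $\mathbf U$ of independent standard Gaussian entries. Let $f(\mathbf Y,(\mathbf B,\mathbf A))$ be the resulting likelihood, i.e. the density at $\mathbf Y$ of the matrix normal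 distribution with mean $\mathbf B\mathbf X_M$, row covariance $\mathbf A\mathbf A^\top$ and column covariance $\mathbf I_n$. The generalized fiducial (GF) Jacobian is, for invertible $\mathbf A$, $$J(\mathbf Y,(\mathbf B,\mathbf A))=\sqrt{\det \mathbf D^\top\mathbf D},$$ where $\mathbf D$ is the $qn\times(q|M|+q^2)$ matrix of partial derivatives of the entries of $G(\mathbf U,(\mathbf B,\mathbf A))$ with respect to the entries of $(\mathbf B,\mathbf A)$, evaluated at $\mathbf U=\mathbf A^{-1}(\mathbf Y-\mathbf B\mathbf X_M)$. Let $h_\epsilon(\mathbf B)\in\{0,1\}$ be the admissibility indicator: $h_\epsilon(\mathbf B)=1$ if $|M|<n-q$ and $\tfrac12\|\widehat{\boldsymbol\Sigma}_M^{-1/2}(\mathbf B\mathbf X_M-\mathbf B_{\min}\mathbf X)\|_{\mathrm F}^2\ge\epsilon$, and $h_\epsilon(\mathbf B)=0$ otherwise, where $\mathbf B_{\min}$ minimizes $\|\widehat{\boldsymbol\Sigma}_M^{-1/2}(\mathbf B\mathbf X_M-\mathbf C\mathbf X)\|_{\mathrm F}^2$ over all $\mathbf C\in\mathbb R^{q\times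 p}$ with at most $|M|-1$ nonzero columns. (For $M=\emptyset$ there is no such $\mathbf C$, and the condition involving $\mathbf B_{\min}$ is considered satisfied. Where $\mathbf X_M\mathbf X_M^\top$ is singular, $(\mathbf X_M\mathbf X_M^\top)^{-1}$ is read as $0$.) The unnormalized GF mass of $M$ and the GF probability mass function over a class $\mathcal K$ of candidate models (for example, all subsets of $\{1,\dots,p\}$) are $$w_\epsilon(M)=\int_{\mathbb R^{q\times|M|}}\int_{\mathbb R^{q\times q}} f(\mathbf Y,(\mathbf B,\mathbf A))\,J(\mathbf Y,(\mathbf B,\mathbf A))\,h_\epsilon(\mathbf B)\,d\mathbf A\,d\mathbf B,\qquad r_\epsilon(M\mid\mathbf Y)=\frac{w_\epsilon(M)}{\sum_{M'\in\mathcal K}w_\epsilon(M')}\quad(M\in\mathcal K),$$ the latter provided that the denominator is positive. Write $\Gamma_q(a)=\pi^{q(q-1)/4}\prod_{j=1}^q\Gamma\bigl(a-\tfrac{j-1}2\bigr)$, and let $T_{q,m}(\nu,\mathbf N,\mathbf S,\mathbf V)$ be the matrix-$t$ distribution on $\mathbb R^{q\times m}$ with density $$\frac{\Gamma_q\bigl(\frac{\nu+m+q-1}2\bigr)}{\pi^{qm/2}\,\Gamma_q\bigl(\frac{\nu+q-1}2\bigr)}(\det\mathbf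 S)^{-m/2}(\det\mathbf V)^{-q/2}\det\bigl(\mathbf I_q+\mathbf S^{-1}(\mathbf T-\mathbf N)\mathbf V^{-1}(\mathbf T-\mathbf N)^\top\bigr)^{-(\nu+m+q-1)/2}.$$ 1. (Jacobian.) For every $M$ such that $\mathbf X_M$ has full row rank, every $\mathbf B$ and every invertible $\mathbf A$, $$J(\mathbf Y,(\mathbf B,\mathbf A))=(\det\mathbf A\mathbf A^\top)^{-q/2}(\det\mathbf X_M\mathbf X_M^\top)^{q/2}(\det\widehat{\boldsymbol\Sigma}_M)^{q/2}.$$ 2. (Marginal mass.) Call $\mathbf Y$ nondegenerate for $M$ if either $\widehat{\boldsymbol\Sigma}_M$ is invertible, or $|M|\ge n-q$, or $\mathbf X_M$ does not have full row rank. There is a constant $c>0$ depending only on $n$ and $q$ such that for all $p,\mathbf X,\mathbf Y,\epsilon$ as above and every $M$ for which $\mathbf Y$ is nondegenerate, the integrand defining $w_\epsilon(M)$ is integrable and $$w_\epsilon(M)=c\;\Gamma_q\Bigl(\frac{n-|M|}2\Bigr)\,\pi^{q|M|/2}\,(\det\widehat{\boldsymbol\Sigma}_M)^{-\frac{n-|M|-q}2}\;\mathbb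 E\bigl[h_\epsilon(\mathbf B_M)\bigr],$$ where $\mathbf B_M\sim T_{q,|M|}\bigl(n-|M|-q+1,\ \widehat{\mathbf B}_M,\ \widehat{\boldsymbol\Sigma}_M,\ (\mathbf X_M\mathbf X_M^\top)^{-1}\bigr)$; for $|M|<n-q$ and $\mathbf X_M$ of full row rank the latter is indeed a probability measure. If $|M|\ge n-q$ or $\mathbf X_M$ does not have full row rank, then $h_\epsilon$ vanishes identically for $M$, and both sides are read as $0$. 3. (Mass function.) Consequently, if $\mathbf Y$ is nondegenerate for every member of $\mathcal K$, then for $M\in\mathcal K$ $$r_\epsilon(M\mid\mathbf Y)\ \propto\ \Gamma_q\Bigl(\frac{n-|M|}2\Bigr)\,\pi^{q|M|/2}\,(\det\widehat{\boldsymbol\Sigma}_M)^{-\frac{n-|M|-q}2}\;\mathbb E\bigl[h_\epsilon(\mathbf B_M)\bigr],$$ that is, $r_\epsilon(M\mid\mathbf Y)$ is the right-hand side divided by its sum over $\mathcal K$. -/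

import Mathlib

open MeasureTheory
open scoped Matrix ENNReal

noncomputable section

namespace EAS

/-! ### Matrix-variate distributions -/

/-- The multivariate gamma function `Γ_q(a) = π^{q(q-1)/4} ∏_{j=1}^{q} Γ(a - (j-1)/2)`. -/
def multiGamma (q : ℕ) (a : ℝ) : ℝ :=
  Real.pi ^ ((q : ℝ) * ((q : ℝ) - 1) / 4) * ∏ j : Fin q, Real.Gamma (a - (j : ℝ) / 2)

/-- Density at `Z` of the matrix normal distribution with mean `N`, row covariance `U` and
column covariance `V`. -/
def matrixNormalPDF {m r : Type*} [Fintype m] [Fintype r] [DecidableEq m] [DecidableEq r]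
    (N : Matrix m r ℝ) (U : Matrix m m ℝ) (V : Matrix r r ℝ) (Z : Matrix m r ℝ) : ℝ :=
  (2 * Real.pi) ^ (-((Fintype.card m : ℝ) * Fintype.card r) / 2)
    * U.det ^ (-(Fintype.card r : ℝ) / 2) * V.det ^ (-(Fintype.card m : ℝ) / 2)
    * Real.exp (-(1 / 2) * (U⁻¹ * (Z - N) * V⁻¹ * (Z - N)ᵀ).trace)

/-- Density at `T` of the matrix `t`-distribution `T_{m,r}(ν, N, U, V)` with `ν` degrees of
freedom, centre `N` and scale matrices `U` (rows) and `V` (columns), with respect to Lebesgue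
measure on `m × r` matrices. -/
def matrixTPDF {m r : Type*} [Fintype m] [Fintype r] [DecidableEq m] [DecidableEq r]
    (ν : ℝ) (N : Matrix m r ℝ) (U : Matrix m m ℝ) (V : Matrix r r ℝ) (T : Matrix m r ℝ) : ℝ :=
  multiGamma (Fintype.card m) ((ν + Fintype.card r + Fintype.card m - 1) / 2)
    / (Real.pi ^ ((Fintype.card m : ℝ) * Fintype.card r / 2)
        * multiGamma (Fintype.card m) ((ν + Fintype.card m - 1) / 2))
    * U.det ^ (-(Fintype.card r : ℝ) / 2) * V.det ^ (-(Fintype.card m : ℝ) / 2)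
    * (1 + U⁻¹ * (T - N) * V⁻¹ * (T - N)ᵀ).det
        ^ (-(ν + Fintype.card r + Fintype.card m - 1) / 2)

/-- The matrix `t`-distribution, as a measure on `m × r` arrays of real numbers. -/
def matrixT {m r : Type*} [Fintype m] [Fintype r] [DecidableEq m] [DecidableEq r]
    (ν : ℝ) (N : Matrix m r ℝ) (U : Matrix m m ℝ) (V : Matrix r r ℝ) : Measure (m → r → ℝ) :=
  (volume : Measure (m → r → ℝ)).withDensity
    fun T => ENNReal.ofReal (matrixTPDF ν N U V (Matrix.of T))

/-! ### Least squares quantities of a model -/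

/-- The rows of the design matrix `X` with index in the model `M`. -/
def designRows {n p : ℕ} (X : Matrix (Fin p) (Fin n) ℝ) (M : Finset (Fin p)) :
    Matrix M (Fin n) ℝ :=
  X.submatrix (fun j : M => (j : Fin p)) id

/-- The Gram matrix `X_M X_Mᵀ`; it is nonsingular iff `X_M` has full row rank. -/
def gram {n p : ℕ} (X : Matrix (Fin p) (Fin n) ℝ) (M : Finset (Fin p)) : Matrix M M ℝ :=
  designRows X M * (designRows X M)ᵀ

/-- The hat matrix `H_M = X_Mᵀ (X_M X_Mᵀ)⁻¹ X_M`. -/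
def hatMatrix {n p : ℕ} (X : Matrix (Fin p) (Fin n) ℝ) (M : Finset (Fin p)) :
    Matrix (Fin n) (Fin n) ℝ :=
  (designRows X M)ᵀ * (gram X M)⁻¹ * designRows X M

/-- The least squares estimator `Y X_Mᵀ (X_M X_Mᵀ)⁻¹`. -/
def lsEstimator {n p q : ℕ} (X : Matrix (Fin p) (Fin n) ℝ) (Y : Matrix (Fin q) (Fin n) ℝ)
    (M : Finset (Fin p)) : Matrix (Fin q) M ℝ :=
  Y * (designRows X M)ᵀ * (gram X M)⁻¹

/-- The residual matrix `Σ̂_M = Y (I - H_M) Yᵀ`. -/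
def sigmaHat {n p q : ℕ} (X : Matrix (Fin p) (Fin n) ℝ) (Y : Matrix (Fin q) (Fin n) ℝ)
    (M : Finset (Fin p)) : Matrix (Fin q) (Fin q) ℝ :=
  Y * (1 - hatMatrix X M) * Yᵀ

/-! ### The `ε`-admissibility function -/

/-- The squared Frobenius norm. -/
def frobSq {m r : Type*} [Fintype m] [Fintype r] (W : Matrix m r ℝ) : ℝ :=
  ∑ i, ∑ j, W i j ^ 2

/-- The inverse of the square root of a positive definite matrix. -/
def invSqrt {m : Type*} [Fintype m] [DecidableEq m] (S : Matrix m m ℝ) : Matrix m m ℝ :=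
  cfc (fun x : ℝ => (Real.sqrt x)⁻¹) S

/-- The objective `‖Σ̂_M^{-1/2} (B_M X_M - C X)‖_F²`. -/
def predDist {n p q : ℕ} (X : Matrix (Fin p) (Fin n) ℝ) (Y : Matrix (Fin q) (Fin n) ℝ)
    (M : Finset (Fin p)) (B : Matrix (Fin q) M ℝ) (C : Matrix (Fin q) (Fin p) ℝ) : ℝ :=
  frobSq (invSqrt (sigmaHat X Y M) * (B * designRows X M - C * X))

/-- The coefficient matrices with at most `|M| - 1` nonzero columns. For the empty model the
bound is `-1` and there are none. -/
def sparser {p : ℕ} (q : ℕ) (M : Finset (Fin p)) : Set (Matrix (Fin q) (Fin p) ℝ) :=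
  {C | {j : Fin p | ∃ i, C i j ≠ 0}.ncard + 1 ≤ M.card}

/-- `C` minimizes the objective over the coefficient matrices with at most `|M| - 1` nonzero
columns. -/
def IsBMin {n p q : ℕ} (X : Matrix (Fin p) (Fin n) ℝ) (Y : Matrix (Fin q) (Fin n) ℝ)
    (M : Finset (Fin p)) (B : Matrix (Fin q) M ℝ) (C : Matrix (Fin q) (Fin p) ℝ) : Prop :=
  C ∈ sparser q M ∧ IsMinOn (predDist X Y M B) (sparser q M) C

open Classical in
/-- The `ε`-admissibility function `h_ε(B_M)`. A minimizer exists for every nonempty model, and all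
minimizers give the same value of the objective. The empty model, which has no sparser
competitor, is admissible as soon as `q < n`. -/
def hEps {n p q : ℕ} (ε : ℝ) (X : Matrix (Fin p) (Fin n) ℝ) (Y : Matrix (Fin q) (Fin n) ℝ)
    (M : Finset (Fin p)) (B : Matrix (Fin q) M ℝ) : ℝ :=
  if (∀ C, IsBMin X Y M B C → ε ≤ 1 / 2 * predDist X Y M B C) ∧ M.card + q < n then 1 else 0

/-! ### The generalized fiducial density -/

/-- The data generating equation `G(U, (B_M, A)) = B_M X_M + A U`. -/
def dataGen {n p q : ℕ} (X : Matrix (Fin p) (Fin n) ℝ) (M : Finset (Fin p))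
    (U : Matrix (Fin q) (Fin n) ℝ) (θ : Matrix (Fin q) M ℝ × Matrix (Fin q) (Fin q) ℝ) :
    Matrix (Fin q) (Fin n) ℝ :=
  θ.1 * designRows X M + θ.2 * U

/-- The inverse `G⁻¹(Y, (B_M, A)) = A⁻¹ (Y - B_M X_M)` of the data generating equation. -/
def dataGenInv {n p q : ℕ} (X : Matrix (Fin p) (Fin n) ℝ) (Y : Matrix (Fin q) (Fin n) ℝ)
    (M : Finset (Fin p)) (θ : Matrix (Fin q) M ℝ × Matrix (Fin q) (Fin q) ℝ) :
    Matrix (Fin q) (Fin n) ℝ :=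
  θ.2⁻¹ * (Y - θ.1 * designRows X M)

/-- `dataGenInv` solves the data generating equation for `U`, and it is the only solution. -/
theorem dataGen_eq_iff {n p q : ℕ} (X : Matrix (Fin p) (Fin n) ℝ) (Y : Matrix (Fin q) (Fin n) ℝ)
    (M : Finset (Fin p)) (θ : Matrix (Fin q) M ℝ × Matrix (Fin q) (Fin q) ℝ)
    (hA : θ.2.det ≠ 0) (U : Matrix (Fin q) (Fin n) ℝ) :
    dataGen X M U θ = Y ↔ U = dataGenInv X Y M θ := by
  have hu : IsUnit θ.2.det := isUnit_iff_ne_zero.mpr hA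
  unfold dataGen dataGenInv
  constructor
  · rintro rfl
    rw [add_sub_cancel_left, Matrix.nonsing_inv_mul_cancel_left _ _ hu]
  · rintro rfl
    rw [Matrix.mul_nonsing_inv_cancel_left _ _ hu, add_sub_cancel]

/-- The coordinate directions of the parameter space: the entries of `B_M`, then those of `A`. -/
def paramDir {p q : ℕ} (M : Finset (Fin p)) :
    (Fin q × M) ⊕ (Fin q × Fin q) → Matrix (Fin q) M ℝ × Matrix (Fin q) (Fin q) ℝ :=
  Sum.elim (fun k => (Matrix.single k.1 k.2 1, 0)) (fun k => (0, Matrix.single k.1 k.2 1))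

/-- The Jacobian matrix of `θ ↦ G(U, θ)`: its entries are the partial derivatives of the `qn`
coordinates of `G` with respect to the `q|M| + q²` scalar parameters. -/
def dataGenDeriv {n p q : ℕ} (X : Matrix (Fin p) (Fin n) ℝ) (M : Finset (Fin p))
    (U : Matrix (Fin q) (Fin n) ℝ) (θ : Matrix (Fin q) M ℝ × Matrix (Fin q) (Fin q) ℝ) :
    Matrix (Fin q × Fin n) ((Fin q × M) ⊕ (Fin q × Fin q)) ℝ :=
  Matrix.of fun i k => deriv (fun t : ℝ => dataGen X M U (θ + t • paramDir M k) i.1 i.2) 0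

/-- The generalized fiducial Jacobian `J(Y, θ) = D(∂G(U, θ)/∂θ)` at `U = G⁻¹(Y, θ)`, where
`D(C) = √(det Cᵀ C)`. -/
def gfJacobian {n p q : ℕ} (X : Matrix (Fin p) (Fin n) ℝ) (Y : Matrix (Fin q) (Fin n) ℝ)
    (M : Finset (Fin p)) (θ : Matrix (Fin q) M ℝ × Matrix (Fin q) (Fin q) ℝ) : ℝ :=
  Real.sqrt ((dataGenDeriv X M (dataGenInv X Y M θ) θ)ᵀ
    * dataGenDeriv X M (dataGenInv X Y M θ) θ).det

/-- The likelihood `f(Y, (B_M, A))` of the model `Y ~ Matrix-Normal(B_M X_M, A Aᵀ, I_n)`. -/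
def likelihood {n p q : ℕ} (X : Matrix (Fin p) (Fin n) ℝ) (Y : Matrix (Fin q) (Fin n) ℝ)
    (M : Finset (Fin p)) (θ : Matrix (Fin q) M ℝ × Matrix (Fin q) (Fin q) ℝ) : ℝ :=
  matrixNormalPDF (θ.1 * designRows X M) (θ.2 * θ.2ᵀ) 1 Y

/-- The unnormalized generalized fiducial density `f(Y, θ) J(Y, θ) h_ε(B_M)` of the parameters
`θ = (B_M, A)`, as a function on pairs of arrays. -/
def gfDensity {n p q : ℕ} (ε : ℝ) (X : Matrix (Fin p) (Fin n) ℝ) (Y : Matrix (Fin q) (Fin n) ℝ)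
    (M : Finset (Fin p)) (θ : (Fin q → M → ℝ) × (Fin q → Fin q → ℝ)) : ℝ :=
  likelihood X Y M (Matrix.of θ.1, Matrix.of θ.2)
    * gfJacobian X Y M (Matrix.of θ.1, Matrix.of θ.2) * hEps ε X Y M (Matrix.of θ.1)

/-- The unnormalized marginal generalized fiducial mass of the model `M`, the integral of the
unnormalized density over all `B_M ∈ ℝ^{q × |M|}` and `A ∈ ℝ^{q × q}`. -/
def gfWeight {n p q : ℕ} (ε : ℝ) (X : Matrix (Fin p) (Fin n) ℝ) (Y : Matrix (Fin q) (Fin n) ℝ)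
    (M : Finset (Fin p)) : ℝ :=
  ∫ θ : (Fin q → M → ℝ) × (Fin q → Fin q → ℝ), gfDensity ε X Y M θ

/-- The generalized fiducial probability mass function `r_ε(M | Y)` over a class `K` of candidate
models. -/
def gfMass {n p q : ℕ} (ε : ℝ) (X : Matrix (Fin p) (Fin n) ℝ) (Y : Matrix (Fin q) (Fin n) ℝ)
    (K : Finset (Finset (Fin p))) (M : Finset (Fin p)) : ℝ :=
  gfWeight ε X Y M / ∑ M' ∈ K, gfWeight ε X Y M'

/-! ### The closed form -/

/-- The distribution `T_{q,|M|}(n - |M| - q + 1, B̂_M, Σ̂_M, (X_M X_Mᵀ)⁻¹)`. -/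
def coefLaw {n p q : ℕ} (X : Matrix (Fin p) (Fin n) ℝ) (Y : Matrix (Fin q) (Fin n) ℝ)
    (M : Finset (Fin p)) : Measure (Fin q → M → ℝ) :=
  matrixT ((n : ℝ) - M.card - q + 1) (lsEstimator X Y M) (sigmaHat X Y M) (gram X M)⁻¹

/-- `Γ_q((n-|M|)/2) π^{q|M|/2} (det Σ̂_M)^{-(n-|M|-q)/2} E[h_ε(B_M)]`. -/
def closedForm {n p q : ℕ} (ε : ℝ) (X : Matrix (Fin p) (Fin n) ℝ) (Y : Matrix (Fin q) (Fin n) ℝ)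
    (M : Finset (Fin p)) : ℝ :=
  multiGamma q (((n : ℝ) - M.card) / 2) * Real.pi ^ ((q : ℝ) * M.card / 2)
    * (sigmaHat X Y M).det ^ (-((n : ℝ) - M.card - q) / 2)
    * ∫ B, hEps ε X Y M (Matrix.of B) ∂(coefLaw X Y M)

/-- The data are nondegenerate for the model `M`: if `|M| < n - q` and `X_M` has full row rank,
then `Σ̂_M` is invertible. -/
def Nondegenerate {n p q : ℕ} (X : Matrix (Fin p) (Fin n) ℝ) (Y : Matrix (Fin q) (Fin n) ℝ)
    (M : Finset (Fin p)) : Prop :=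
  M.card + q < n → (gram X M).det ≠ 0 → (sigmaHat X Y M).det ≠ 0

end EAS

end

namespace EAS

/-! ### The Jacobian -/

section Jacobian
open Matrix

/-! Jacobian. `G` is affine in the parameters, and row i of `G` involves only row i of `B` and of
`A`. Regrouping the parameters by rows therefore turns the derivative into `I_q ⊗ Wᵀ`, where `W`
stacks `X_M` on `U`, so `det DᵀD = det(W Wᵀ)^q`. A Schur complement splits `det(W Wᵀ)` into the Gram
determinant times the determinant of the residual matrix of `U`. At `U = A⁻¹(Y - B X_M)` the
projection `I - H_M` kills `B X_M`, and that residual matrix is `A⁻¹ Σ̂ A⁻ᵀ` (`det_dataGenDeriv`,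
`sigmaHat_dataGenInv`).

Mass. Put `S_B = (Y - B X_M)(Y - B X_M)ᵀ`. Likelihood times Jacobian depends on `A` through
`det(AAᵀ)^(-(n+q)/2) exp(-tr((AAᵀ)⁻¹ S_B)/2)`. With `S_B = L Lᵀ`, the substitution `A ↦ L A` shows
that its integral over `A` is `det(S_B)^(-n/2)` times a number depending on n and q only
(`lintegral_scaleKernel`). This number is finite: inverting `A` turns it into a Gaussian moment of
`|det A|^(n-q)` (`scaleConst_lt_top`). By Pythagoras `S_B = Σ̂ + (B - B̂) X_M X_Mᵀ (B - B̂)ᵀ`, so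
`det(S_B)^(-n/2)` is a power of `det Σ̂` times the kernel of the matrix t-density. Collecting
constants leaves the closed form times `massConst` (`coef_mul_det_rpow_eq`).

That the t-law has mass one is proved by integrating out the columns one at a time; each step is a
vector integral with a rank-one determinant, and the gamma factors telescope
(`lintegral_det_one_add_sum_vecMulVec_rpow`).

Degenerate models carry no mass: if the Gram matrix is singular, every `B X_M` has an exact sparser
representation, at distance 0 < ε, so `h_ε` vanishes. In the mass function the common constant
cancels. -/

theorem gram_transpose {n p : ℕ} (X : Matrix (Fin p) (Fin n) ℝ) (M : Finset (Fin p)) :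
    (gram X M)ᵀ = gram X M := by
  simp [gram, Matrix.transpose_mul]

theorem gram_posSemidef {n p : ℕ} (X : Matrix (Fin p) (Fin n) ℝ) (M : Finset (Fin p)) :
    (gram X M).PosSemidef := by
  have := Matrix.posSemidef_self_mul_conjTranspose (designRows X M)
  rwa [Matrix.conjTranspose_eq_transpose_of_trivial] at this

theorem gram_posDef {n p : ℕ} {X : Matrix (Fin p) (Fin n) ℝ} {M : Finset (Fin p)}
    (h : (gram X M).det ≠ 0) : (gram X M).PosDef :=
  (gram_posSemidef X M).posDef_iff_isUnit.2
    ((Matrix.isUnit_iff_isUnit_det _).2 (isUnit_iff_ne_zero.2 h))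

theorem hatMatrix_transpose {n p : ℕ} (X : Matrix (Fin p) (Fin n) ℝ) (M : Finset (Fin p)) :
    (hatMatrix X M)ᵀ = hatMatrix X M := by
  simp [hatMatrix, Matrix.transpose_mul, Matrix.transpose_nonsing_inv, gram_transpose,
    Matrix.mul_assoc]

theorem designRows_mul_hatMatrix {n p : ℕ} {X : Matrix (Fin p) (Fin n) ℝ} {M : Finset (Fin p)}
    (h : (gram X M).det ≠ 0) : designRows X M * hatMatrix X M = designRows X M := by
  have hu : IsUnit (gram X M).det := isUnit_iff_ne_zero.2 h
  rw [hatMatrix, ← Matrix.mul_assoc, ← Matrix.mul_assoc, ← gram, Matrix.mul_nonsing_inv _ hu,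
    Matrix.one_mul]

theorem hatMatrix_mul_transpose {n p : ℕ} {X : Matrix (Fin p) (Fin n) ℝ} {M : Finset (Fin p)}
    (h : (gram X M).det ≠ 0) :
    hatMatrix X M * (designRows X M)ᵀ = (designRows X M)ᵀ := by
  have := congrArg Matrix.transpose (designRows_mul_hatMatrix h)
  rwa [Matrix.transpose_mul, hatMatrix_transpose] at this

theorem hatMatrix_mul_self {n p : ℕ} {X : Matrix (Fin p) (Fin n) ℝ} {M : Finset (Fin p)}
    (h : (gram X M).det ≠ 0) : hatMatrix X M * hatMatrix X M = hatMatrix X M := by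
  conv_lhs => enter [1]; rw [hatMatrix]
  rw [Matrix.mul_assoc, designRows_mul_hatMatrix h, ← hatMatrix]

/-- `I - H_M` is a symmetric idempotent. This form makes the residual matrix positive semidefinite
and lets it be computed from the residuals alone. -/
theorem sigmaHat_eq_mul_transpose {n p q : ℕ} {X : Matrix (Fin p) (Fin n) ℝ}
    (Y : Matrix (Fin q) (Fin n) ℝ) {M : Finset (Fin p)} (h : (gram X M).det ≠ 0) :
    sigmaHat X Y M = (Y * (1 - hatMatrix X M)) * (Y * (1 - hatMatrix X M))ᵀ := by
  have h1 : (1 - hatMatrix X M) * (1 - hatMatrix X M) = 1 - hatMatrix X M := by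
    rw [Matrix.mul_sub, Matrix.sub_mul, Matrix.sub_mul, hatMatrix_mul_self h]; simp
  rw [Matrix.transpose_mul, Matrix.transpose_sub, Matrix.transpose_one, hatMatrix_transpose,
    Matrix.mul_assoc, ← Matrix.mul_assoc (1 - hatMatrix X M), h1, sigmaHat, Matrix.mul_assoc]

theorem sigmaHat_posSemidef {n p q : ℕ} {X : Matrix (Fin p) (Fin n) ℝ}
    (Y : Matrix (Fin q) (Fin n) ℝ) {M : Finset (Fin p)} (h : (gram X M).det ≠ 0) :
    (sigmaHat X Y M).PosSemidef := by
  have := Matrix.posSemidef_self_mul_conjTranspose (Y * (1 - hatMatrix X M))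
  rwa [Matrix.conjTranspose_eq_transpose_of_trivial, ← sigmaHat_eq_mul_transpose Y h] at this

theorem sigmaHat_posDef {n p q : ℕ} {X : Matrix (Fin p) (Fin n) ℝ}
    {Y : Matrix (Fin q) (Fin n) ℝ} {M : Finset (Fin p)} (h : (gram X M).det ≠ 0)
    (h' : (sigmaHat X Y M).det ≠ 0) : (sigmaHat X Y M).PosDef :=
  (sigmaHat_posSemidef Y h).posDef_iff_isUnit.2
    ((Matrix.isUnit_iff_isUnit_det _).2 (isUnit_iff_ne_zero.2 h'))

/-- The residual matrix only depends on the data modulo the row space of `X_M`. -/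
theorem sigmaHat_dataGenInv {n p q : ℕ} {X : Matrix (Fin p) (Fin n) ℝ}
    (Y : Matrix (Fin q) (Fin n) ℝ) {M : Finset (Fin p)} (h : (gram X M).det ≠ 0)
    (B : Matrix (Fin q) M ℝ) (A : Matrix (Fin q) (Fin q) ℝ) :
    sigmaHat X (dataGenInv X Y M (B, A)) M = A⁻¹ * sigmaHat X Y M * (A⁻¹)ᵀ := by
  have h1 : dataGenInv X Y M (B, A) * (1 - hatMatrix X M) = A⁻¹ * (Y * (1 - hatMatrix X M)) := by
    simp only [dataGenInv, Matrix.mul_assoc]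
    rw [Matrix.sub_mul Y, Matrix.mul_assoc, Matrix.mul_sub (designRows X M),
      designRows_mul_hatMatrix h]
    simp
  rw [sigmaHat_eq_mul_transpose _ h, h1, sigmaHat_eq_mul_transpose _ h, Matrix.transpose_mul A⁻¹]
  simp only [Matrix.mul_assoc]

theorem dataGenDeriv_inl {n p q : ℕ} (X : Matrix (Fin p) (Fin n) ℝ) (M : Finset (Fin p))
    (U : Matrix (Fin q) (Fin n) ℝ) (θ : Matrix (Fin q) M ℝ × Matrix (Fin q) (Fin q) ℝ)
    (i : Fin q × Fin n) (k : Fin q × M) :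
    dataGenDeriv X M U θ i (Sum.inl k) = if i.1 = k.1 then designRows X M k.2 i.2 else 0 := by
  have : (fun t : ℝ => dataGen X M U (θ + t • paramDir M (Sum.inl k)) i.1 i.2)
      = fun t : ℝ => dataGen X M U θ i.1 i.2
        + t * (if i.1 = k.1 then designRows X M k.2 i.2 else 0) := by
    funext t
    simp only [dataGen, paramDir, Sum.elim_inl, Prod.fst_add, Prod.snd_add, Prod.smul_fst,
      Prod.smul_snd, smul_zero, add_zero, Matrix.add_mul, Matrix.add_apply, Matrix.smul_mul,
      Matrix.smul_apply, smul_eq_mul]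
    have : (Matrix.single k.1 k.2 (1 : ℝ) * designRows X M) i.1 i.2
        = if i.1 = k.1 then designRows X M k.2 i.2 else 0 := by
      split_ifs with hi
      · rw [hi, Matrix.single_mul_apply_same, one_mul]
      · rw [Matrix.single_mul_apply_of_ne _ _ _ _ _ hi]
    rw [this]; ring
  rw [dataGenDeriv, Matrix.of_apply, this]
  exact (((hasDerivAt_id (0 : ℝ)).mul_const _).const_add _).deriv.trans (one_mul _)

theorem dataGenDeriv_inr {n p q : ℕ} (X : Matrix (Fin p) (Fin n) ℝ) (M : Finset (Fin p))
    (U : Matrix (Fin q) (Fin n) ℝ) (θ : Matrix (Fin q) M ℝ × Matrix (Fin q) (Fin q) ℝ)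
    (i : Fin q × Fin n) (k : Fin q × Fin q) :
    dataGenDeriv X M U θ i (Sum.inr k) = if i.1 = k.1 then U k.2 i.2 else 0 := by
  have : (fun t : ℝ => dataGen X M U (θ + t • paramDir M (Sum.inr k)) i.1 i.2)
      = fun t : ℝ => dataGen X M U θ i.1 i.2
        + t * (if i.1 = k.1 then U k.2 i.2 else 0) := by
    funext t
    simp only [dataGen, paramDir, Sum.elim_inr, Prod.fst_add, Prod.snd_add, Prod.smul_fst,
      Prod.smul_snd, smul_zero, add_zero, Matrix.add_mul, Matrix.add_apply, Matrix.smul_mul,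
      Matrix.smul_apply, smul_eq_mul]
    have : (Matrix.single k.1 k.2 (1 : ℝ) * U) i.1 i.2
        = if i.1 = k.1 then U k.2 i.2 else 0 := by
      split_ifs with hi
      · rw [hi, Matrix.single_mul_apply_same, one_mul]
      · rw [Matrix.single_mul_apply_of_ne _ _ _ _ _ hi]
    rw [this]; ring
  rw [dataGenDeriv, Matrix.of_apply, this]
  exact (((hasDerivAt_id (0 : ℝ)).mul_const _).const_add _).deriv.trans (one_mul _)

open scoped Kronecker in
-- The identity factor records that the rows of `G` decouple. The relabelling gathers, for each row
-- index, the entries of `B` and of `A` in that row.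
theorem dataGenDeriv_eq_kronecker {n p q : ℕ} (X : Matrix (Fin p) (Fin n) ℝ) (M : Finset (Fin p))
    (U : Matrix (Fin q) (Fin n) ℝ) (θ : Matrix (Fin q) M ℝ × Matrix (Fin q) (Fin q) ℝ) :
    dataGenDeriv X M U θ =
      ((1 : Matrix (Fin q) (Fin q) ℝ) ⊗ₖ (Matrix.fromRows (designRows X M) U)ᵀ).submatrix id
        (Equiv.prodSumDistrib (Fin q) M (Fin q)).symm := by
  ext i k
  rcases k with k | k
  · rw [dataGenDeriv_inl]
    simp [Matrix.one_apply]
  · rw [dataGenDeriv_inr]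
    simp [Matrix.one_apply]

/-- `DᵀD` is `I_q ⊗ W Wᵀ` up to relabelling, and the Schur complement of the Gram block in `W Wᵀ` is
exactly `U (I - H_M) Uᵀ`. -/
theorem det_dataGenDeriv {n p q : ℕ} {X : Matrix (Fin p) (Fin n) ℝ} {M : Finset (Fin p)}
    (h : (gram X M).det ≠ 0)
    (U : Matrix (Fin q) (Fin n) ℝ) (θ : Matrix (Fin q) M ℝ × Matrix (Fin q) (Fin q) ℝ) :
    ((dataGenDeriv X M U θ)ᵀ * dataGenDeriv X M U θ).det =
      ((gram X M).det * (sigmaHat X U M).det) ^ q := by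
  have : Invertible (gram X M) :=
    Matrix.invertibleOfIsUnitDet _ (isUnit_iff_ne_zero.2 h)
  rw [dataGenDeriv_eq_kronecker, Matrix.transpose_submatrix]
  set W := Matrix.fromRows (designRows X M) U
  set e := (Equiv.prodSumDistrib (Fin q) M (Fin q)).symm
  have h1 := Matrix.submatrix_mul_equiv
    (Matrix.kroneckerMap (fun x y : ℝ => x * y) (1 : Matrix (Fin q) (Fin q) ℝ) Wᵀ)ᵀ
    (Matrix.kroneckerMap (fun x y : ℝ => x * y) (1 : Matrix (Fin q) (Fin q) ℝ) Wᵀ)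
    e (Equiv.refl _) e
  rw [Equiv.coe_refl] at h1
  have h2 : W * Wᵀ = Matrix.fromBlocks (gram X M) (designRows X M * Uᵀ)
      (U * (designRows X M)ᵀ) (U * Uᵀ) := by
    rw [Matrix.transpose_fromRows, Matrix.fromRows_mul_fromCols, gram]
  rw [h1, Matrix.det_submatrix_equiv_self, ← Matrix.kroneckerMap_transpose,
    ← Matrix.mul_kronecker_mul, Matrix.det_kronecker, Matrix.transpose_transpose, h2,
    Matrix.det_fromBlocks₁₁]
  simp only [Matrix.transpose_one, mul_one, Matrix.det_one, one_pow, one_mul, Fintype.card_fin,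
    Matrix.invOf_eq_nonsing_inv]
  rw [sigmaHat, hatMatrix, Matrix.mul_sub, Matrix.mul_one, Matrix.sub_mul]
  simp only [Matrix.mul_assoc]

/-- The closed form of the generalized fiducial Jacobian. -/
theorem gfJacobian_eq {n p q : ℕ} {X : Matrix (Fin p) (Fin n) ℝ} (Y : Matrix (Fin q) (Fin n) ℝ)
    {M : Finset (Fin p)} (B : Matrix (Fin q) M ℝ) {A : Matrix (Fin q) (Fin q) ℝ}
    (h : (gram X M).det ≠ 0) (hA : A.det ≠ 0) :
    gfJacobian X Y M (B, A) =
      (A * Aᵀ).det ^ (-(q : ℝ) / 2) * (gram X M).det ^ ((q : ℝ) / 2)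
        * (sigmaHat X Y M).det ^ ((q : ℝ) / 2) := by
  have hG : 0 < (gram X M).det := (gram_posDef h).det_pos
  have hS : 0 ≤ (sigmaHat X Y M).det := (sigmaHat_posSemidef Y h).det_nonneg
  have hAA : (A * Aᵀ).det = A.det ^ 2 := by rw [Matrix.det_mul, Matrix.det_transpose, sq]
  have hAp : 0 < (A * Aᵀ).det := by rw [hAA]; positivity
  have h1 : (sigmaHat X (dataGenInv X Y M (B, A)) M).det
      = (A * Aᵀ).det⁻¹ * (sigmaHat X Y M).det := by
    rw [sigmaHat_dataGenInv Y h, Matrix.det_mul, Matrix.det_mul, Matrix.det_transpose,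
      Matrix.det_nonsing_inv, Ring.inverse_eq_inv', hAA]
    field_simp
  rw [gfJacobian, det_dataGenDeriv h, h1, Real.sqrt_eq_rpow, ← Real.rpow_natCast,
    ← Real.rpow_mul (by positivity), Real.mul_rpow hG.le (by positivity),
    Real.mul_rpow (by positivity) hS, Real.inv_rpow hAp.le, neg_div, Real.rpow_neg hAp.le]
  ring_nf

end Jacobian
/-! ### The admissibility function -/

section Admissibility

theorem frobSq_nonneg {m r : Type*} [Fintype m] [Fintype r] (W : Matrix m r ℝ) : 0 ≤ frobSq W :=
  Finset.sum_nonneg fun _ _ => Finset.sum_nonneg fun _ _ => sq_nonneg _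

theorem hEps_eq_zero_or_one {n p q : ℕ} (ε : ℝ) (X : Matrix (Fin p) (Fin n) ℝ)
    (Y : Matrix (Fin q) (Fin n) ℝ) (M : Finset (Fin p)) (B : Matrix (Fin q) M ℝ) :
    hEps ε X Y M B = 0 ∨ hEps ε X Y M B = 1 := by
  unfold hEps
  split_ifs <;> simp

theorem hEps_nonneg {n p q : ℕ} (ε : ℝ) (X : Matrix (Fin p) (Fin n) ℝ)
    (Y : Matrix (Fin q) (Fin n) ℝ) (M : Finset (Fin p)) (B : Matrix (Fin q) M ℝ) :
    0 ≤ hEps ε X Y M B := by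
  rcases hEps_eq_zero_or_one ε X Y M B with h | h <;> simp [h]

theorem hEps_le_one {n p q : ℕ} (ε : ℝ) (X : Matrix (Fin p) (Fin n) ℝ)
    (Y : Matrix (Fin q) (Fin n) ℝ) (M : Finset (Fin p)) (B : Matrix (Fin q) M ℝ) :
    hEps ε X Y M B ≤ 1 := by
  rcases hEps_eq_zero_or_one ε X Y M B with h | h <;> simp [h]

/-- If the Gram matrix is singular, every fitted mean has a strictly sparser representation. -/
theorem exists_sparser_of_gram_det_eq_zero {n p q : ℕ} {X : Matrix (Fin p) (Fin n) ℝ}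
    {M : Finset (Fin p)} (h : (gram X M).det = 0) (B : Matrix (Fin q) M ℝ) :
    ∃ C ∈ sparser q M, B * designRows X M = C * X := by
  obtain ⟨v, hv, hv0⟩ := Matrix.exists_vecMul_eq_zero_iff.2 h
  -- A null vector of the Gram matrix annihilates `X_M` itself, since `v X_M X_Mᵀ vᵀ` is the squared
  -- length of `v X_M`.
  have hv1 : v ᵥ* designRows X M = 0 := by
    have h1 : (v ᵥ* designRows X M) ⬝ᵥ (v ᵥ* designRows X M) = 0 := by
      have : (v ᵥ* gram X M) ⬝ᵥ v = 0 := by rw [hv0, zero_dotProduct]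
      rwa [gram, ← Matrix.vecMul_vecMul, Matrix.vecMul_transpose, dotProduct_comm,
        Matrix.dotProduct_mulVec] at this
    exact dotProduct_self_eq_zero.1 h1
  obtain ⟨j, hj⟩ := Function.ne_iff.1 hv
  rw [Pi.zero_apply] at hj
  -- Subtracting multiples of the relation `v` from the rows of `B` leaves `B X_M` unchanged; these
  -- multiples are chosen to clear column `j`.
  let D : Matrix (Fin q) M ℝ := B - Matrix.of fun i k => B i j / v j * v k
  have hD : D * designRows X M = B * designRows X M := by
    ext i l
    have h2 : ∑ k, v k * designRows X M k l = 0 := congrFun hv1 l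
    have h3 : ∑ k, B i j / v j * v k * designRows X M k l = 0 := by
      simp_rw [mul_assoc]
      rw [← Finset.mul_sum, h2, mul_zero]
    simp only [D, Matrix.sub_mul, Matrix.sub_apply]
    rw [sub_eq_self, Matrix.mul_apply]
    exact h3
  refine ⟨Matrix.of fun i k => if hk : k ∈ M then D i ⟨k, hk⟩ else 0, ?_, ?_⟩
  · have hs : {k : Fin p | ∃ i, (Matrix.of fun i k => if hk : k ∈ M then D i ⟨k, hk⟩ else 0) i k ≠ 0}
        ⊆ (M.erase j : Finset (Fin p)) := by
      rintro k ⟨i, hi⟩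
      simp only [Matrix.of_apply, ne_eq, dite_eq_right_iff, not_forall] at hi
      obtain ⟨hk, hi⟩ := hi
      simp only [Finset.coe_erase, Set.mem_sdiff, Finset.mem_coe, Set.mem_singleton_iff]
      refine ⟨hk, ?_⟩
      rintro rfl
      apply hi
      simp only [D, Matrix.sub_apply, Matrix.of_apply]
      field_simp
      simp
    have h4 := Set.ncard_le_ncard hs (Finset.finite_toSet _)
    rw [Set.ncard_coe_finset, Finset.card_erase_of_mem j.2] at h4
    have h5 : 0 < M.card := Finset.card_pos.2 ⟨j, j.2⟩
    change _ + 1 ≤ M.card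
    omega
  · rw [← hD]
    ext i l
    simp only [Matrix.mul_apply, Matrix.of_apply, designRows, Matrix.submatrix_apply, id_eq]
    rw [← Finset.sum_subset (Finset.subset_univ M), ← Finset.sum_coe_sort M]
    · exact Finset.sum_congr rfl fun k _ => by simp
    · intro k _ hk
      simp [hk]

/-- The implication in `h` covers both excluded cases at once: too large a model, or a singular Gram
matrix. In the latter the exact sparser representation attains distance 0, hence is a minimizer and
violates the bound by ε. -/
theorem hEps_eq_zero_of_gram_det_eq_zero {n p q : ℕ} {ε : ℝ} (hε : 0 < ε)
    {X : Matrix (Fin p) (Fin n) ℝ} (Y : Matrix (Fin q) (Fin n) ℝ) {M : Finset (Fin p)}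
    (h : M.card + q < n → (gram X M).det = 0) (B : Matrix (Fin q) M ℝ) :
    hEps ε X Y M B = 0 := by
  rw [hEps, if_neg]
  rintro ⟨h1, h2⟩
  obtain ⟨C, hC, hBC⟩ := exists_sparser_of_gram_det_eq_zero (h h2) B
  have h0 : predDist X Y M B C = 0 := by
    rw [predDist, hBC, sub_self, Matrix.mul_zero]
    simp [frobSq]
  have := h1 C ⟨hC, fun C' _ => h0.trans_le (frobSq_nonneg _)⟩
  rw [h0] at this
  linarith

/-! ### Existence of a best sparser competitor -/

section
attribute [local instance] Matrix.frobeniusNormedAddCommGroup Matrix.frobeniusNormedSpace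

theorem frobSq_eq_norm_sq {m r : Type*} [Fintype m] [Fintype r] (W : Matrix m r ℝ) :
    frobSq W = ‖W‖ ^ 2 := by
  rw [Matrix.frobenius_norm_def, ← Real.sqrt_eq_rpow, Real.sq_sqrt (by positivity)]
  simp [frobSq]

/-- The image under `L` is a finite union of subspaces, hence closed, and a nonempty closed set in a
finite-dimensional space has a point nearest to `Z`. -/
theorem exists_frobSq_sub_le_of_finite_union {V m r : Type*} [Fintype m] [Fintype r]
    [AddCommGroup V] [Module ℝ V] [FiniteDimensional ℝ V] (L : V →ₗ[ℝ] Matrix m r ℝ)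
    (Z : Matrix m r ℝ) {ι : Type*} {T : Set ι} (hT : T.Finite) (P : ι → Submodule ℝ V)
    (hne : T.Nonempty) :
    ∃ C ∈ ⋃ i ∈ T, (P i : Set V), ∀ C' ∈ ⋃ i ∈ T, (P i : Set V),
      frobSq (Z - L C) ≤ frobSq (Z - L C') := by
  have hcl : IsClosed (L '' ⋃ i ∈ T, (P i : Set V)) := by
    rw [Set.image_iUnion₂]
    refine hT.isClosed_biUnion fun i _ => ?_
    rw [← Submodule.map_coe]
    exact Submodule.closed_of_finiteDimensional _
  have hne' : (L '' ⋃ i ∈ T, (P i : Set V)).Nonempty := by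
    obtain ⟨i, hi⟩ := hne
    exact ⟨_, 0, Set.mem_biUnion hi (P i).zero_mem, rfl⟩
  have : ProperSpace (Matrix m r ℝ) := FiniteDimensional.proper ℝ _
  obtain ⟨_, ⟨C, hC, rfl⟩, h⟩ := hcl.exists_infDist_eq_dist hne' Z
  refine ⟨C, hC, fun C' hC' => ?_⟩
  have h1 : dist Z (L C) ≤ dist Z (L C') := h ▸ Metric.infDist_le_dist_of_mem ⟨C', hC', rfl⟩
  rw [dist_eq_norm, dist_eq_norm] at h1
  rw [frobSq_eq_norm_sq, frobSq_eq_norm_sq]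
  gcongr

end

/-- The sparser matrices form the finite union, over small column supports `s`, of the coordinate
subspaces `P s`. -/
theorem exists_isBMin {n p q : ℕ} (X : Matrix (Fin p) (Fin n) ℝ) (Y : Matrix (Fin q) (Fin n) ℝ)
    (M : Finset (Fin p)) (B : Matrix (Fin q) M ℝ) (hM : (sparser q M).Nonempty) :
    ∃ C, IsBMin X Y M B C := by
  let P : Finset (Fin p) → Submodule ℝ (Matrix (Fin q) (Fin p) ℝ) := fun s =>
    { carrier := {C | ∀ j ∉ s, ∀ i, C i j = 0}
      add_mem' := fun ha hb j hj i => by simp [ha j hj i, hb j hj i]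
      zero_mem' := fun j _ i => rfl
      smul_mem' := fun c a ha j hj i => by simp [ha j hj i] }
  let T : Set (Finset (Fin p)) := {s | s.card + 1 ≤ M.card}
  have hU : sparser q M = ⋃ s ∈ T, (P s : Set (Matrix (Fin q) (Fin p) ℝ)) := by
    ext C
    simp only [Set.mem_iUnion, exists_prop]
    constructor
    · intro hC
      refine ⟨(Set.toFinite {j : Fin p | ∃ i, C i j ≠ 0}).toFinset, ?_, fun j hj i => ?_⟩
      · change _ + 1 ≤ _
        rw [← Set.ncard_eq_toFinset_card]
        exact hC
      · simp only [Set.Finite.mem_toFinset, Set.mem_ofPred_eq, not_exists, not_not] at hj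
        exact hj i
    · rintro ⟨s, hs, hC⟩
      have : {j : Fin p | ∃ i, C i j ≠ 0} ⊆ (s : Set (Fin p)) := by
        rintro j ⟨i, hi⟩
        by_contra hj
        exact hi (hC j hj i)
      have h1 := Set.ncard_le_ncard this (Finset.finite_toSet _)
      rw [Set.ncard_coe_finset] at h1
      change s.card + 1 ≤ M.card at hs
      change _ + 1 ≤ _
      omega
  have hT : T.Nonempty := by
    obtain ⟨C, hC⟩ := hM
    rw [hU] at hC
    simp only [Set.mem_iUnion, exists_prop] at hC
    exact ⟨_, hC.choose_spec.1⟩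
  let W := invSqrt (sigmaHat X Y M)
  let L : Matrix (Fin q) (Fin p) ℝ →ₗ[ℝ] Matrix (Fin q) (Fin n) ℝ :=
    { toFun := fun C => W * (C * X)
      map_add' := fun a b => by rw [Matrix.add_mul, Matrix.mul_add]
      map_smul' := fun c a => by simp }
  obtain ⟨C, hC, h⟩ := exists_frobSq_sub_le_of_finite_union L (W * (B * designRows X M))
    (Set.toFinite T) P hT
  rw [← hU] at hC h
  refine ⟨C, hC, fun C' hC' => ?_⟩
  have := h C' hC'
  simp only [L, LinearMap.coe_mk, AddHom.coe_mk, ← Matrix.mul_sub] at this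
  exact this

/-- The admissibility condition as a condition on all sparser competitors. -/
theorem forall_isBMin_iff {n p q : ℕ} (ε : ℝ) (X : Matrix (Fin p) (Fin n) ℝ)
    (Y : Matrix (Fin q) (Fin n) ℝ) (M : Finset (Fin p)) (B : Matrix (Fin q) M ℝ) :
    (∀ C, IsBMin X Y M B C → ε ≤ 1 / 2 * predDist X Y M B C) ↔
      ∀ C ∈ sparser q M, ε ≤ 1 / 2 * predDist X Y M B C := by
  constructor
  · intro h C hC
    obtain ⟨C₀, h₀⟩ := exists_isBMin X Y M B ⟨C, hC⟩
    have h1 := h C₀ h₀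
    have h2 : predDist X Y M B C₀ ≤ predDist X Y M B C := h₀.2 hC
    linarith
  · exact fun h C hC => h C hC.1

/-- The minimizers vary with `B`, but bounding all competitors instead exhibits the condition as an
intersection of closed conditions on `B`. -/
theorem measurable_hEps {n p q : ℕ} (ε : ℝ) (X : Matrix (Fin p) (Fin n) ℝ)
    (Y : Matrix (Fin q) (Fin n) ℝ) (M : Finset (Fin p)) :
    Measurable fun B : Fin q → M → ℝ => hEps ε X Y M (Matrix.of B) := by
  have hset : MeasurableSet {B : Fin q → M → ℝ |
      (∀ C, IsBMin X Y M (Matrix.of B) C → ε ≤ 1 / 2 * predDist X Y M (Matrix.of B) C)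
        ∧ M.card + q < n} := by
    simp_rw [forall_isBMin_iff]
    have hc : IsClosed {B : Fin q → M → ℝ |
        ∀ C ∈ sparser q M, ε ≤ 1 / 2 * predDist X Y M (Matrix.of B) C} := by
      simp only [Set.ofPred_forall]
      refine isClosed_iInter fun C => isClosed_iInter fun _ => isClosed_le continuous_const ?_
      simp only [predDist, frobSq, Matrix.mul_apply, Matrix.sub_apply, Matrix.of_apply]
      fun_prop
    exact hc.measurableSet.inter (MeasurableSet.const _)
  unfold hEps
  exact Measurable.ite hset measurable_const measurable_const

end Admissibility
/-! ### Linear changes of variables in Lebesgue integrals -/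

section ChangeOfVariables

/-- An injective linear map is a measurable embedding, so `g` need not be measurable. -/
theorem lintegral_comp_linearMap {E : Type*} [NormedAddCommGroup E] [NormedSpace ℝ E]
    [MeasurableSpace E] [BorelSpace E] [FiniteDimensional ℝ E] (μ : Measure E)
    [μ.IsAddHaarMeasure] {f : E →ₗ[ℝ] E} (hf : LinearMap.det f ≠ 0) (g : E → ℝ≥0∞) :
    ∫⁻ x, g x ∂μ = ENNReal.ofReal |LinearMap.det f| * ∫⁻ x, g (f x) ∂μ := by
  have hinj : Function.Injective f := (LinearMap.equivOfDetNeZero f hf).injective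
  have he : MeasurableEmbedding f :=
    (LinearMap.isClosedEmbedding_of_injective (LinearMap.ker_eq_bot.2 hinj)).measurableEmbedding
  have h1 := he.lintegral_map (μ := μ) g
  rw [Measure.map_linearMap_addHaar_eq_smul_addHaar μ hf, lintegral_smul_measure] at h1
  rw [← h1, smul_eq_mul, ← mul_assoc, ← ENNReal.ofReal_mul (abs_nonneg _), ← abs_mul,
    mul_inv_cancel₀ hf]
  simp

/-- The linear map `T ↦ L T R` on arrays. -/
def leftRightMul {m r : Type*} [Fintype m] [Fintype r] (L : Matrix m m ℝ) (R : Matrix r r ℝ) :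
    (m → r → ℝ) →ₗ[ℝ] (m → r → ℝ) where
  toFun T := Matrix.of.symm (L * Matrix.of T * R)
  map_add' S T := by
    rw [← Matrix.of_add_of, Matrix.mul_add, Matrix.add_mul]; rfl
  map_smul' c T := by
    rw [← Matrix.smul_of, Matrix.mul_smul, Matrix.smul_mul]; rfl

open scoped Kronecker in
-- Stacking columns turns `T ↦ L T R` into multiplication by `Rᵀ ⊗ L`.
theorem det_leftRightMul {m r : Type*} [Fintype m] [Fintype r] [DecidableEq m] [DecidableEq r]
    (L : Matrix m m ℝ) (R : Matrix r r ℝ) :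
    LinearMap.det (leftRightMul L R) = L.det ^ Fintype.card r * R.det ^ Fintype.card m := by
  let e : (m → r → ℝ) ≃ₗ[ℝ] (r × m → ℝ) :=
    { toFun := fun T => Matrix.vec (Matrix.of T)
      invFun := fun v i j => v (j, i)
      left_inv := fun T => rfl
      right_inv := fun v => rfl
      map_add' := fun S T => rfl
      map_smul' := fun c T => rfl }
  have h : (e : (m → r → ℝ) →ₗ[ℝ] (r × m → ℝ)) ∘ₗ leftRightMul L R ∘ₗ
      (e.symm : (r × m → ℝ) →ₗ[ℝ] (m → r → ℝ)) = Matrix.toLin' (Rᵀ ⊗ₖ L) := by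
    refine LinearMap.ext fun v => ?_
    rw [Matrix.toLin'_apply]
    have := Matrix.kronecker_mulVec_vec L (Matrix.of (e.symm v)) Rᵀ
    rw [Matrix.transpose_transpose] at this
    exact this.symm
  rw [← LinearMap.det_conj (leftRightMul L R) e, h, LinearMap.det_toLin', Matrix.det_kronecker,
    Matrix.det_transpose, mul_comm]

theorem lintegral_leftRightMul {m r : Type*} [Fintype m] [Fintype r] [DecidableEq m]
    [DecidableEq r] {L : Matrix m m ℝ} {R : Matrix r r ℝ} (hL : L.det ≠ 0) (hR : R.det ≠ 0)
    (g : Matrix m r ℝ → ℝ≥0∞) :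
    ∫⁻ T : m → r → ℝ, g (Matrix.of T) =
      ENNReal.ofReal (|L.det| ^ Fintype.card r * |R.det| ^ Fintype.card m)
        * ∫⁻ T : m → r → ℝ, g (L * Matrix.of T * R) := by
  have hd : LinearMap.det (leftRightMul L R) ≠ 0 := by
    rw [det_leftRightMul]; positivity
  rw [lintegral_comp_linearMap volume hd, det_leftRightMul, abs_mul, abs_pow, abs_pow]
  rfl

/-- A linear equivalence which maps some set of measure one onto a set of measure one preserves
Lebesgue measure. -/
theorem measurePreserving_of_volume_eq_one {E F : Type*} [NormedAddCommGroup E] [NormedSpace ℝ E]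
    [FiniteDimensional ℝ E] [MeasureSpace E] [BorelSpace E]
    [(volume : Measure E).IsAddHaarMeasure] [NormedAddCommGroup F] [NormedSpace ℝ F]
    [FiniteDimensional ℝ F] [MeasureSpace F] [BorelSpace F]
    [(volume : Measure F).IsAddHaarMeasure] (e : E ≃L[ℝ] F) {K : Set F} (hKm : MeasurableSet K)
    (hK : volume K = 1) (hK' : volume (e ⁻¹' K) = 1) :
    MeasurePreserving e (volume : Measure E) (volume : Measure F) := by
  refine ⟨e.continuous.measurable, ?_⟩
  have := Measure.isAddLeftInvariant_eq_smul (Measure.map e (volume : Measure E))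
    (volume : Measure F)
  rw [this]
  have h1 := congrArg (fun μ : Measure F => μ K) this
  simp only [Measure.map_apply e.continuous.measurable hKm, hK', Measure.smul_apply, hK] at h1
  ext s _
  have h2 : (Measure.map e (volume : Measure E)).addHaarScalarFactor volume = 1 := by
    simpa using h1.symm
  rw [h2, one_smul]

theorem volume_pi_pi_Icc_zero_one (m r : Type*) [Fintype m] [Fintype r] :
    volume (Set.univ.pi fun _ : m => Set.univ.pi fun _ : r => Set.Icc (0 : ℝ) 1) = 1 := by
  rw [volume_pi_pi]
  simp only [volume_pi_pi]
  simp

/-- The transposition `r × m → m × r` of arrays, after a relabelling of the columns, preserves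
Lebesgue measure. -/
theorem lintegral_transpose_reindex {m r k : Type*} [Fintype m] [Fintype r] [Fintype k]
    (σ : k ≃ r) (g : (m → r → ℝ) → ℝ≥0∞) :
    ∫⁻ T : m → r → ℝ, g T = ∫⁻ V : k → m → ℝ, g (fun i j => V (σ.symm j) i) := by
  let e₀ : (k → m → ℝ) ≃ₗ[ℝ] (m → r → ℝ) :=
    { toFun := fun V i j => V (σ.symm j) i
      invFun := fun T l i => T i (σ l)
      left_inv := fun V => by simp
      right_inv := fun T => by simp
      map_add' := fun S T => rfl
      map_smul' := fun c T => rfl }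
  let e := e₀.toContinuousLinearEquiv
  have hpre : e ⁻¹' (Set.univ.pi fun _ : m => Set.univ.pi fun _ : r => Set.Icc (0 : ℝ) 1)
      = Set.univ.pi fun _ : k => Set.univ.pi fun _ : m => Set.Icc (0 : ℝ) 1 := by
    ext V
    simp only [Set.mem_preimage, Set.mem_univ_pi]
    constructor
    · intro h l i
      have := h i (σ l)
      simpa [e, e₀] using this
    · intro h i j
      exact h (σ.symm j) i
  have hmp := measurePreserving_of_volume_eq_one e
    (K := Set.univ.pi fun _ : m => Set.univ.pi fun _ : r => Set.Icc (0 : ℝ) 1)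
    (MeasurableSet.univ_pi fun _ => MeasurableSet.univ_pi fun _ => measurableSet_Icc)
    (volume_pi_pi_Icc_zero_one m r) (by rw [hpre]; exact volume_pi_pi_Icc_zero_one k m)
  exact (hmp.lintegral_comp_emb e.toHomeomorph.measurableEmbedding g).symm

end ChangeOfVariables

/-! ### Factorization of positive definite matrices and measurability of determinants -/

section MatrixLemmas

theorem exists_mul_transpose_eq {m : Type*} [Fintype m] [DecidableEq m] {S : Matrix m m ℝ}
    (hS : S.PosDef) : ∃ L : Matrix m m ℝ, L * Lᵀ = S ∧ L.det ≠ 0 := by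
  obtain ⟨L, hL⟩ : ∃ L : Matrix m m ℝ, L * Lᵀ = S := by
    open scoped MatrixOrder in
    obtain ⟨B, hB⟩ := CStarAlgebra.nonneg_iff_eq_mul_star_self.1 hS.posSemidef.nonneg
    exact ⟨B, by rw [hB, Matrix.star_eq_conjTranspose,
      Matrix.conjTranspose_eq_transpose_of_trivial]⟩
  refine ⟨L, hL, fun h0 => hS.det_pos.ne' ?_⟩
  rw [← hL, Matrix.det_mul, h0, zero_mul]

theorem measurable_det {α m : Type*} [MeasurableSpace α] [Fintype m] [DecidableEq m]
    {F : α → Matrix m m ℝ} (h : ∀ i j, Measurable fun x => F x i j) :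
    Measurable fun x => (F x).det := by
  simp only [Matrix.det_apply]
  fun_prop

end MatrixLemmas

/-! ### The normalization of the matrix `t`-distribution -/

section VectorIntegral

/-- The Bochner integral of a non-integrable function is 0, so a known nonzero value certifies
integrability. This transfers real integral formulas to `∫⁻`. -/
theorem integrable_of_integral_ne_zero {α : Type*} [MeasurableSpace α] {μ : Measure α}
    {f : α → ℝ} (h : ∫ x, f x ∂μ ≠ 0) : Integrable f μ := by
  by_contra h'
  exact h (integral_undef h')

theorem lintegral_rpow_mul_exp_neg_mul_Ioi {a r : ℝ} (ha : 0 < a) (hr : 0 < r) :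
    ∫⁻ t in Set.Ioi (0 : ℝ), ENNReal.ofReal (t ^ (a - 1) * Real.exp (-(r * t)))
      = ENNReal.ofReal (r ^ (-a) * Real.Gamma a) := by
  have h := Real.integral_rpow_mul_exp_neg_mul_Ioi ha hr
  have h0 : (1 / r) ^ a * Real.Gamma a = r ^ (-a) * Real.Gamma a := by
    rw [one_div, Real.inv_rpow hr.le, Real.rpow_neg hr.le]
  rw [h0] at h
  have hp : 0 < r ^ (-a) * Real.Gamma a := by
    have := Real.Gamma_pos_of_pos ha
    positivity
  rw [← h, ofReal_integral_eq_lintegral_ofReal]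
  · exact integrable_of_integral_ne_zero (by rw [h]; exact hp.ne')
  · refine (ae_restrict_iff' measurableSet_Ioi).2 (Filter.Eventually.of_forall fun t ht => ?_)
    have : (0 : ℝ) < t := ht
    simp only [Pi.zero_apply]
    positivity

theorem lintegral_exp_neg_mul_dotProduct {ι : Type*} [Fintype ι] {t : ℝ} (ht : 0 < t) :
    ∫⁻ s : ι → ℝ, ENNReal.ofReal (Real.exp (-(t * (s ⬝ᵥ s))))
      = ENNReal.ofReal ((Real.pi / t) ^ ((Fintype.card ι : ℝ) / 2)) := by
  have h := integral_fintype_prod_volume_eq_pow (𝕜 := ℝ) (ι := ι)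
    (fun x : ℝ => Real.exp (-t * x ^ 2))
  rw [integral_gaussian] at h
  have h1 : ∀ s : ι → ℝ, ∏ i, Real.exp (-t * s i ^ 2) = Real.exp (-(t * (s ⬝ᵥ s))) := by
    intro s
    rw [← Real.exp_sum, dotProduct, ← Finset.mul_sum]
    simp [sq]
  simp_rw [h1] at h
  have h2 : √(Real.pi / t) ^ Fintype.card ι = (Real.pi / t) ^ ((Fintype.card ι : ℝ) / 2) := by
    have : 0 ≤ Real.pi / t := by positivity
    rw [Real.sqrt_eq_rpow, ← Real.rpow_natCast, ← Real.rpow_mul this]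
    ring_nf
  rw [h2] at h
  rw [← h, ofReal_integral_eq_lintegral_ofReal]
  · refine integrable_of_integral_ne_zero ?_
    rw [h]
    positivity
  · exact Filter.Eventually.of_forall fun s => (Real.exp_pos _).le

/-- Write `Γ(a)(1 + |s|²)^(-a)` as the integral of `t^(a-1) exp(-(1 + |s|²)t)` and swap. The
Gaussian integral over `s` contributes `(π/t)^k`, and what remains is `Γ(a - k)`, which needs `k <
a`. -/
theorem lintegral_one_add_dotProduct_rpow {ι : Type*} [Fintype ι] {a : ℝ}
    (ha : (Fintype.card ι : ℝ) / 2 < a) :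
    ∫⁻ s : ι → ℝ, ENNReal.ofReal ((1 + s ⬝ᵥ s) ^ (-a))
      = ENNReal.ofReal (Real.pi ^ ((Fintype.card ι : ℝ) / 2)
          * Real.Gamma (a - (Fintype.card ι : ℝ) / 2) / Real.Gamma a) := by
  set k : ℝ := (Fintype.card ι : ℝ) / 2 with hk
  have hk0 : 0 ≤ k := by positivity
  have ha0 : 0 < a := hk0.trans_lt ha
  have hΓ := Real.Gamma_pos_of_pos ha0
  have hpos : ∀ s : ι → ℝ, 0 ≤ s ⬝ᵥ s := fun s =>
    Finset.sum_nonneg fun i _ => mul_self_nonneg _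
  have h1 : ENNReal.ofReal (Real.Gamma a) * ∫⁻ s : ι → ℝ, ENNReal.ofReal ((1 + s ⬝ᵥ s) ^ (-a))
      = ENNReal.ofReal (Real.pi ^ k * Real.Gamma (a - k)) := by
    rw [← lintegral_const_mul' _ _ ENNReal.ofReal_ne_top]
    have h2 : ∀ s : ι → ℝ,
        ENNReal.ofReal (Real.Gamma a) * ENNReal.ofReal ((1 + s ⬝ᵥ s) ^ (-a))
          = ∫⁻ t in Set.Ioi (0 : ℝ),
              ENNReal.ofReal (t ^ (a - 1) * Real.exp (-((1 + s ⬝ᵥ s) * t))) := by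
      intro s
      have := hpos s
      rw [lintegral_rpow_mul_exp_neg_mul_Ioi ha0 (by positivity), ← ENNReal.ofReal_mul hΓ.le,
        mul_comm]
    simp_rw [h2]
    rw [lintegral_lintegral_swap]
    · have h3 : ∀ t ∈ Set.Ioi (0 : ℝ),
          ∫⁻ s : ι → ℝ, ENNReal.ofReal (t ^ (a - 1) * Real.exp (-((1 + s ⬝ᵥ s) * t)))
            = ENNReal.ofReal (Real.pi ^ k)
              * ENNReal.ofReal (t ^ (a - k - 1) * Real.exp (-(1 * t))) := by
        intro t ht
        have ht0 : (0 : ℝ) < t := ht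
        have h4 : ∀ s : ι → ℝ,
            ENNReal.ofReal (t ^ (a - 1) * Real.exp (-((1 + s ⬝ᵥ s) * t)))
              = ENNReal.ofReal (t ^ (a - 1) * Real.exp (-t))
                * ENNReal.ofReal (Real.exp (-(t * (s ⬝ᵥ s)))) := by
          intro s
          rw [← ENNReal.ofReal_mul (by positivity), mul_assoc, ← Real.exp_add]
          ring_nf
        simp_rw [h4]
        rw [lintegral_const_mul' _ _ ENNReal.ofReal_ne_top, lintegral_exp_neg_mul_dotProduct ht0,
          ← ENNReal.ofReal_mul (by positivity), ← ENNReal.ofReal_mul (by positivity), ← hk,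
          Real.div_rpow Real.pi_pos.le ht0.le, sub_right_comm a k 1, Real.rpow_sub ht0 (a - 1) k]
        ring_nf
      rw [setLIntegral_congr_fun measurableSet_Ioi h3,
        lintegral_const_mul' _ _ ENNReal.ofReal_ne_top,
        lintegral_rpow_mul_exp_neg_mul_Ioi (by linarith) one_pos,
        ← ENNReal.ofReal_mul (by positivity), Real.one_rpow, one_mul]
    · refine Measurable.aemeasurable ?_
      simp only [Function.uncurry_def, dotProduct]
      fun_prop
  rw [← ENNReal.mul_right_inj (a := ENNReal.ofReal (Real.Gamma a)) (by simpa using hΓ)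
    ENNReal.ofReal_ne_top, h1, ← ENNReal.ofReal_mul hΓ.le]
  congr 1
  field_simp

end VectorIntegral

/-! ### The matrix t-integral, column by column -/

section MatrixIntegral

theorem vecMulVec_mulVec_mulVec {m : Type*} [Fintype m] (L : Matrix m m ℝ) (u : m → ℝ) :
    Matrix.vecMulVec (L *ᵥ u) (L *ᵥ u) = L * Matrix.vecMulVec u u * Lᵀ := by
  rw [Matrix.mul_vecMulVec, Matrix.vecMulVec_mul, Matrix.vecMul_transpose]

theorem det_one_add_vecMulVec {m : Type*} [Fintype m] [DecidableEq m] (u v : m → ℝ) :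
    (1 + Matrix.vecMulVec u v).det = 1 + v ⬝ᵥ u := by
  rw [Matrix.vecMulVec_eq Unit, Matrix.det_one_add_replicateCol_mul_replicateRow]

/-- With `P = L Lᵀ` and `s = L u` the determinant becomes `det P · (1 + |u|²)`. The substitution
contributes one factor `|det L| = (det P)^(1/2)`, which shifts the exponent from `a` to `a - 1/2`.
-/
theorem lintegral_det_add_vecMulVec_rpow {ι : Type*} [Fintype ι] [DecidableEq ι] {a : ℝ}
    (ha : (Fintype.card ι : ℝ) / 2 < a) {P : Matrix ι ι ℝ} (hP : P.PosDef) :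
    ∫⁻ s : ι → ℝ, ENNReal.ofReal ((P + Matrix.vecMulVec s s).det ^ (-a))
      = ENNReal.ofReal (Real.pi ^ ((Fintype.card ι : ℝ) / 2)
          * Real.Gamma (a - (Fintype.card ι : ℝ) / 2) / Real.Gamma a)
        * ENNReal.ofReal (P.det ^ (-(a - 1 / 2))) := by
  obtain ⟨L, rfl, hL⟩ := exists_mul_transpose_eq hP
  have hd : LinearMap.det (Matrix.toLin' L) ≠ 0 := by rwa [LinearMap.det_toLin']
  rw [lintegral_comp_linearMap volume hd, LinearMap.det_toLin']
  have hdet : (L * Lᵀ).det = |L.det| ^ 2 := by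
    rw [Matrix.det_mul, Matrix.det_transpose, sq_abs, sq]
  have hLp : 0 < |L.det| := abs_pos.2 hL
  have h1 : ∀ u : ι → ℝ,
      ENNReal.ofReal ((L * Lᵀ + Matrix.vecMulVec (Matrix.toLin' L u) (Matrix.toLin' L u)).det
        ^ (-a)) = ENNReal.ofReal ((|L.det| ^ 2) ^ (-a))
          * ENNReal.ofReal ((1 + u ⬝ᵥ u) ^ (-a)) := by
    intro u
    have : 0 ≤ u ⬝ᵥ u := Finset.sum_nonneg fun i _ => mul_self_nonneg _
    have h2 : L * Lᵀ + Matrix.vecMulVec (Matrix.toLin' L u) (Matrix.toLin' L u)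
        = L * (1 + Matrix.vecMulVec u u) * Lᵀ := by
      rw [Matrix.toLin'_apply, vecMulVec_mulVec_mulVec, Matrix.mul_add, Matrix.add_mul,
        Matrix.mul_one]
    rw [h2, Matrix.det_mul, Matrix.det_mul, Matrix.det_transpose, det_one_add_vecMulVec,
      mul_right_comm, ← sq, ← sq_abs, Real.mul_rpow (by positivity) (by positivity),
      ENNReal.ofReal_mul (by positivity)]
  simp_rw [h1]
  rw [lintegral_const_mul' _ _ ENNReal.ofReal_ne_top, lintegral_one_add_dotProduct_rpow ha, hdet,
    ← mul_assoc, mul_comm (ENNReal.ofReal _ * ENNReal.ofReal _),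
    ← ENNReal.ofReal_mul hLp.le]
  congr 2
  rw [← Real.rpow_natCast, ← Real.rpow_mul hLp.le, ← Real.rpow_mul hLp.le]
  conv_lhs => enter [1]; rw [← Real.rpow_one |L.det|]
  rw [← Real.rpow_add hLp]
  congr 1
  push_cast
  ring

theorem posDef_one_add_sum_vecMulVec {ι κ : Type*} [Fintype ι] [DecidableEq ι] [Fintype κ]
    (V : κ → ι → ℝ) : (1 + ∑ k, Matrix.vecMulVec (V k) (V k)).PosDef := by
  refine Matrix.PosDef.add_posSemidef Matrix.PosDef.one ?_
  refine Matrix.posSemidef_sum _ fun k _ => ?_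
  have := Matrix.posSemidef_vecMulVec_self_star (V k)
  rwa [star_trivial] at this

theorem multiGamma_pos {q : ℕ} {a : ℝ} (h : ((q : ℝ) - 1) / 2 < a) : 0 < multiGamma q a := by
  refine mul_pos (Real.rpow_pos_of_pos Real.pi_pos _) (Finset.prod_pos fun j _ => ?_)
  refine Real.Gamma_pos_of_pos ?_
  have : ((j : ℕ) : ℝ) + 1 ≤ q := by exact_mod_cast j.2
  linarith

/-- Both sides come from the product of `Γ(a - j/2)` over j = 0, …, q, splitting off its first or
its last factor. -/
theorem multiGamma_sub_half (q : ℕ) (a : ℝ) :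
    multiGamma q (a - 1 / 2) * Real.Gamma a = multiGamma q a * Real.Gamma (a - q / 2) := by
  have h1 : (∏ j : Fin q, Real.Gamma (a - 1 / 2 - (j : ℝ) / 2)) * Real.Gamma a
      = (∏ j : Fin q, Real.Gamma (a - (j : ℝ) / 2)) * Real.Gamma (a - q / 2) := by
    have h2 := Fin.prod_univ_succ fun j : Fin (q + 1) => Real.Gamma (a - ((j : ℕ) : ℝ) / 2)
    have h3 := Fin.prod_univ_castSucc fun j : Fin (q + 1) => Real.Gamma (a - ((j : ℕ) : ℝ) / 2)
    rw [h2] at h3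
    simp only [Fin.val_zero, Fin.val_succ, Fin.val_castSucc, Fin.val_last, Nat.cast_zero, zero_div,
      sub_zero] at h3
    rw [← h3, mul_comm]
    congr 1
    refine Finset.prod_congr rfl fun j _ => ?_
    push_cast
    ring_nf
  rw [multiGamma, multiGamma, mul_assoc, h1, mul_assoc]

/-- Induction on the number of vectors: one is integrated out with the others frozen in `P`. This
lowers the exponent by 1/2, as the induction hypothesis requires, and `multiGamma_sub_half` absorbs
the gamma quotient. -/
theorem lintegral_det_one_add_sum_vecMulVec_rpow {ι : Type*} [Fintype ι] [DecidableEq ι] (m : ℕ)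
    {a : ℝ} (ha : ((Fintype.card ι : ℝ) + m - 1) / 2 < a) :
    ∫⁻ V : Fin m → ι → ℝ,
        ENNReal.ofReal ((1 + ∑ k, Matrix.vecMulVec (V k) (V k)).det ^ (-a))
      = ENNReal.ofReal (Real.pi ^ ((Fintype.card ι : ℝ) * m / 2)
          * multiGamma (Fintype.card ι) (a - m / 2) / multiGamma (Fintype.card ι) a) := by
  induction m generalizing a with
  | zero =>
    -- The domain is a single point of mass one; positivity is what makes the gamma quotient equal
    -- to 1.
    have := multiGamma_pos (q := Fintype.card ι) (a := a) (by push_cast at ha; linarith)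
    simp [volume_pi, this.ne']
  | succ m ih =>
    push_cast at ha
    have hm : (0 : ℝ) ≤ m := Nat.cast_nonneg m
    have ha1 : (Fintype.card ι : ℝ) / 2 < a := by linarith
    rw [← (volume_preserving_piFinSuccAbove (fun _ : Fin (m + 1) => ι → ℝ) 0).symm.lintegral_comp_emb
      (MeasurableEquiv.measurableEmbedding _)]
    rw [Measure.volume_eq_prod, lintegral_prod_symm]
    · have h1 : ∀ V : Fin m → ι → ℝ, ∀ s : ι → ℝ,
          (1 + ∑ k, Matrix.vecMulVec
            ((MeasurableEquiv.piFinSuccAbove (fun _ : Fin (m + 1) => ι → ℝ) 0).symm (s, V) k)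
            ((MeasurableEquiv.piFinSuccAbove (fun _ : Fin (m + 1) => ι → ℝ) 0).symm (s, V) k))
          = (1 + ∑ k, Matrix.vecMulVec (V k) (V k)) + Matrix.vecMulVec s s := by
        intro V s
        rw [Fin.sum_univ_succ]
        simp only [MeasurableEquiv.piFinSuccAbove, Fin.insertNthEquiv_zero,
          MeasurableEquiv.symm_mk, MeasurableEquiv.coe_mk, Equiv.symm_symm, Fin.consEquiv_apply,
          Fin.cons_zero, Fin.cons_succ]
        abel
      simp_rw [h1]
      simp_rw [fun V : Fin m → ι → ℝ =>
        lintegral_det_add_vecMulVec_rpow ha1 (posDef_one_add_sum_vecMulVec V)]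
      rw [lintegral_const_mul' _ _ ENNReal.ofReal_ne_top, ih (a := a - 1 / 2) (by linarith)]
      have hg := Real.Gamma_pos_of_pos (s := a) (by linarith [Nat.cast_nonneg (α := ℝ) (Fintype.card ι)])
      have hg2 := Real.Gamma_pos_of_pos (s := a - (Fintype.card ι : ℝ) / 2) (by linarith)
      have hΓ := multiGamma_sub_half (Fintype.card ι) a
      have hp := multiGamma_pos (q := Fintype.card ι) (a := a) (by linarith)
      have hp2 := multiGamma_pos (q := Fintype.card ι) (a := a - 1 / 2) (by linarith)
      rw [← ENNReal.ofReal_mul (by positivity)]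
      congr 1
      have e1 : a - 1 / 2 - (m : ℝ) / 2 = a - ((m + 1 : ℕ) : ℝ) / 2 := by push_cast; ring
      have e2 : Real.pi ^ ((Fintype.card ι : ℝ) * ((m + 1 : ℕ) : ℝ) / 2)
          = Real.pi ^ ((Fintype.card ι : ℝ) / 2) * Real.pi ^ ((Fintype.card ι : ℝ) * m / 2) := by
        rw [← Real.rpow_add Real.pi_pos]
        congr 1
        push_cast
        ring
      rw [e1, e2]
      generalize multiGamma (Fintype.card ι) (a - ((m + 1 : ℕ) : ℝ) / 2) = x
      generalize multiGamma (Fintype.card ι) (a - 1 / 2) = y at *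
      generalize Real.Gamma (a - (Fintype.card ι : ℝ) / 2) = z at *
      field_simp
      linear_combination (-x) * hΓ
    · refine Measurable.aemeasurable ?_
      refine ENNReal.measurable_ofReal.comp (Measurable.pow_const (measurable_det fun i j => ?_) _)
      simp only [Matrix.add_apply, Matrix.sum_apply, Matrix.vecMulVec_apply]
      fun_prop

theorem lintegral_det_one_add_mul_transpose_rpow {ι κ : Type*} [Fintype ι] [DecidableEq ι]
    [Fintype κ] {a : ℝ} (ha : ((Fintype.card ι : ℝ) + Fintype.card κ - 1) / 2 < a) :
    ∫⁻ T : ι → κ → ℝ,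
        ENNReal.ofReal ((1 + Matrix.of T * (Matrix.of T)ᵀ).det ^ (-a))
      = ENNReal.ofReal (Real.pi ^ ((Fintype.card ι : ℝ) * Fintype.card κ / 2)
          * multiGamma (Fintype.card ι) (a - (Fintype.card κ : ℝ) / 2)
            / multiGamma (Fintype.card ι) a) := by
  rw [← lintegral_det_one_add_sum_vecMulVec_rpow (Fintype.card κ) ha,
    lintegral_transpose_reindex (Fintype.equivFin κ).symm]
  refine lintegral_congr fun V => ?_
  congr 4
  ext i j
  simp only [Matrix.mul_apply, Matrix.of_apply, Matrix.transpose_apply, Matrix.sum_apply,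
    Matrix.vecMulVec_apply, Equiv.symm_symm]
  exact (Fintype.equivFin κ).sum_comp fun k => V k i * V k j

/-- Translate by `N`, then substitute `T ↦ L T Rᵀ` with `U = L Lᵀ` and `V = R Rᵀ`: the matrix inside
the determinant becomes a conjugate of `1 + T Tᵀ`. -/
theorem lintegral_matrixT_kernel {ι κ : Type*} [Fintype ι] [DecidableEq ι] [Fintype κ]
    [DecidableEq κ] {a : ℝ} (ha : ((Fintype.card ι : ℝ) + Fintype.card κ - 1) / 2 < a)
    (N : Matrix ι κ ℝ) {U : Matrix ι ι ℝ} {V : Matrix κ κ ℝ} (hU : U.PosDef) (hV : V.PosDef) :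
    ∫⁻ T : ι → κ → ℝ, ENNReal.ofReal
        ((1 + U⁻¹ * (Matrix.of T - N) * V⁻¹ * (Matrix.of T - N)ᵀ).det ^ (-a))
      = ENNReal.ofReal (U.det ^ ((Fintype.card κ : ℝ) / 2) * V.det ^ ((Fintype.card ι : ℝ) / 2)
          * (Real.pi ^ ((Fintype.card ι : ℝ) * Fintype.card κ / 2)
          * multiGamma (Fintype.card ι) (a - (Fintype.card κ : ℝ) / 2)
            / multiGamma (Fintype.card ι) a)) := by
  have h0 := lintegral_sub_right_eq_self (μ := (volume : Measure (ι → κ → ℝ)))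
    (fun T : ι → κ → ℝ => ENNReal.ofReal
      ((1 + U⁻¹ * Matrix.of T * V⁻¹ * (Matrix.of T)ᵀ).det ^ (-a))) (Matrix.of.symm N)
  have h0' : ∀ T : ι → κ → ℝ, Matrix.of (T - Matrix.of.symm N) = Matrix.of T - N := fun T => rfl
  simp_rw [h0'] at h0
  rw [h0]
  obtain ⟨L, rfl, hL⟩ := exists_mul_transpose_eq hU
  obtain ⟨R, rfl, hR⟩ := exists_mul_transpose_eq hV
  have hRT : Rᵀ.det ≠ 0 := by rwa [Matrix.det_transpose]
  refine (lintegral_leftRightMul hL hRT (fun T : Matrix ι κ ℝ => ENNReal.ofReal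
      ((1 + (L * Lᵀ)⁻¹ * T * (R * Rᵀ)⁻¹ * Tᵀ).det ^ (-a)))).trans ?_
  have h1 : ∀ T : Matrix ι κ ℝ,
      (1 + (L * Lᵀ)⁻¹ * (L * T * Rᵀ) * (R * Rᵀ)⁻¹ * (L * T * Rᵀ)ᵀ).det
        = (1 + T * Tᵀ).det := by
    intro T
    have hLu : IsUnit L.det := hL.isUnit
    have hLtu : IsUnit Lᵀ.det := by rw [Matrix.det_transpose]; exact hLu
    have hRu : IsUnit R.det := hR.isUnit
    have hRtu : IsUnit Rᵀ.det := by rw [Matrix.det_transpose]; exact hRu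
    have h2 : (L * Lᵀ)⁻¹ * (L * T * Rᵀ) * (R * Rᵀ)⁻¹ * (L * T * Rᵀ)ᵀ
        = Lᵀ⁻¹ * (T * Tᵀ) * Lᵀ := by
      simp only [Matrix.mul_inv_rev, Matrix.transpose_mul, Matrix.transpose_transpose,
        Matrix.mul_assoc]
      rw [Matrix.nonsing_inv_mul_cancel_left _ _ hLu, Matrix.mul_nonsing_inv_cancel_left _ _ hRtu,
        Matrix.nonsing_inv_mul_cancel_left _ _ hRu]
    have h3 : (1 : Matrix ι ι ℝ) = Lᵀ⁻¹ * 1 * Lᵀ := by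
      rw [Matrix.mul_one, Matrix.nonsing_inv_mul _ hLtu]
    conv_lhs => rw [h2, h3]
    rw [← Matrix.add_mul, ← Matrix.mul_add, Matrix.det_mul, Matrix.det_mul, mul_right_comm,
      ← Matrix.det_mul, Matrix.nonsing_inv_mul _ hLtu, Matrix.det_one, one_mul]
  simp_rw [h1]
  have habs : ∀ {x : ℝ} (k : ℕ), |x| ^ k = (x * x) ^ ((k : ℝ) / 2) := by
    intro x k
    rw [← sq, ← sq_abs, ← Real.rpow_natCast, ← Real.rpow_natCast, ← Real.rpow_mul (abs_nonneg x)]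
    congr 1
    push_cast
    ring
  rw [lintegral_det_one_add_mul_transpose_rpow ha, ← ENNReal.ofReal_mul (by positivity)]
  simp only [Matrix.det_mul, Matrix.det_transpose, habs]

theorem isProbabilityMeasure_matrixT {ι κ : Type*} [Fintype ι] [DecidableEq ι] [Fintype κ]
    [DecidableEq κ] {ν : ℝ} (hν : 0 < ν) (N : Matrix ι κ ℝ) {U : Matrix ι ι ℝ}
    {V : Matrix κ κ ℝ} (hU : U.PosDef) (hV : V.PosDef) :
    IsProbabilityMeasure (matrixT ν N U V) := by
  constructor
  rw [matrixT, withDensity_apply _ MeasurableSet.univ, Measure.restrict_univ]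
  set a := (ν + Fintype.card κ + Fintype.card ι - 1) / 2 with ha
  have hκ : (0 : ℝ) ≤ Fintype.card κ := Nat.cast_nonneg _
  have ha1 : ((Fintype.card ι : ℝ) + Fintype.card κ - 1) / 2 < a := by
    rw [ha]; linarith
  have hp := multiGamma_pos (q := Fintype.card ι) (a := a) (by linarith)
  have e : (ν + Fintype.card ι - 1) / 2 = a - (Fintype.card κ : ℝ) / 2 := by rw [ha]; ring
  have hp2 := multiGamma_pos (q := Fintype.card ι) (a := a - (Fintype.card κ : ℝ) / 2)
    (by linarith)
  have hUd := hU.det_pos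
  have hVd := hV.det_pos
  have e2 : -(ν + Fintype.card κ + Fintype.card ι - 1) / 2 = -a := by rw [ha]; ring
  simp only [matrixTPDF]
  rw [← ha, e, e2]
  have h1 : ∀ x : ℝ, ENNReal.ofReal (multiGamma (Fintype.card ι) a
      / (Real.pi ^ ((Fintype.card ι : ℝ) * Fintype.card κ / 2)
        * multiGamma (Fintype.card ι) (a - (Fintype.card κ : ℝ) / 2))
      * U.det ^ (-(Fintype.card κ : ℝ) / 2) * V.det ^ (-(Fintype.card ι : ℝ) / 2) * x)
      = ENNReal.ofReal (multiGamma (Fintype.card ι) a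
      / (Real.pi ^ ((Fintype.card ι : ℝ) * Fintype.card κ / 2)
        * multiGamma (Fintype.card ι) (a - (Fintype.card κ : ℝ) / 2))
      * U.det ^ (-(Fintype.card κ : ℝ) / 2) * V.det ^ (-(Fintype.card ι : ℝ) / 2))
        * ENNReal.ofReal x := fun x => ENNReal.ofReal_mul (by positivity)
  simp_rw [h1]
  rw [lintegral_const_mul' _ _ ENNReal.ofReal_ne_top, lintegral_matrixT_kernel ha1 N hU hV,
    ← ENNReal.ofReal_mul (by positivity), neg_div, neg_div, Real.rpow_neg hUd.le,
    Real.rpow_neg hVd.le]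
  have : ∀ x : ℝ, x = 1 → ENNReal.ofReal x = 1 := by rintro x rfl; simp
  apply this
  have := Real.rpow_pos_of_pos hUd ((Fintype.card κ : ℝ) / 2)
  have := Real.rpow_pos_of_pos hVd ((Fintype.card ι : ℝ) / 2)
  generalize multiGamma (Fintype.card ι) (a - (Fintype.card κ : ℝ) / 2) = x at *
  field_simp

end MatrixIntegral
/-! ### The integral over the scale matrix -/

section Scale

-- The derivative `H ↦ -A⁻¹ H A⁻¹` is expressed through `leftRightMul`, whose determinant is known.
attribute [local instance] Matrix.linftyOpNormedRing Matrix.linftyOpNormedAlgebra in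
theorem hasFDerivAt_nonsing_inv {m : Type*} [Fintype m] [DecidableEq m] {A : m → m → ℝ}
    (hA : (Matrix.of A).det ≠ 0) :
    HasFDerivAt (fun B : m → m → ℝ => Matrix.of.symm (Matrix.of B)⁻¹)
      (LinearMap.toContinuousLinearMap
        (leftRightMul (-(Matrix.of A)⁻¹) (Matrix.of A)⁻¹)) A := by
  obtain ⟨u, hu⟩ := (Matrix.isUnit_iff_isUnit_det _).2 hA.isUnit
  have h := hasFDerivAt_ringInverse (𝕜 := ℝ) u
  have h1 : (fun B : m → m → ℝ => Matrix.of.symm (Matrix.of B)⁻¹)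
      = (Ring.inverse : Matrix m m ℝ → Matrix m m ℝ) := by
    funext B
    exact congrArg Matrix.of.symm (Matrix.nonsing_inv_eq_ringInverse (Matrix.of B))
  rw [h1]
  rw [hu] at h
  have h2 : -((ContinuousLinearMap.mulLeftRight ℝ (Matrix m m ℝ)) ↑u⁻¹) ↑u⁻¹
      = LinearMap.toContinuousLinearMap
        (leftRightMul (-(Matrix.of A)⁻¹) (Matrix.of A)⁻¹) := by
    ext1 H
    have h3 : (↑u⁻¹ : Matrix m m ℝ) = (Matrix.of A)⁻¹ := by
      rw [← hu, Matrix.coe_units_inv]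
    simp only [h3, neg_apply, ContinuousLinearMap.mulLeftRight_apply]
    rw [← neg_mul, ← neg_mul]
    rfl
  rw [h2] at h
  exact h

theorem measurable_nonsing_inv {α m : Type*} [MeasurableSpace α] [Fintype m] [DecidableEq m]
    {F : α → Matrix m m ℝ} (h : ∀ i j, Measurable fun x => F x i j) (i j : m) :
    Measurable fun x => (F x)⁻¹ i j := by
  simp only [Matrix.inv_def, Ring.inverse_eq_inv', Matrix.smul_apply, smul_eq_mul,
    Matrix.adjugate_apply]
  refine (measurable_det h).inv.mul (measurable_det fun k l => ?_)
  by_cases hk : k = j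
  · subst hk
    simp
  · simpa [Matrix.updateRow_ne hk] using h k l

theorem measurable_matrix_mul {α l m r : Type*} [MeasurableSpace α] [Fintype m]
    {F : α → Matrix l m ℝ} {G : α → Matrix m r ℝ} (hF : ∀ i j, Measurable fun x => F x i j)
    (hG : ∀ i j, Measurable fun x => G x i j) (i : l) (j : r) :
    Measurable fun x => (F x * G x) i j := by
  simp only [Matrix.mul_apply]
  exact Finset.measurable_sum _ fun k _ => (hF i k).mul (hG k j)

/-- The unnormalized density of the scale matrix `A` when the residual cross product matrix
is `S`. -/
noncomputable def scaleKernel (n : ℝ) {m : Type*} [Fintype m] [DecidableEq m] (S A : Matrix m m ℝ) : ℝ :=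
  (A * Aᵀ).det ^ (-(n + Fintype.card m) / 2)
    * Real.exp (-(1 / 2) * ((A * Aᵀ)⁻¹ * S).trace)

theorem det_mul_transpose_self {m : Type*} [Fintype m] [DecidableEq m] (A : Matrix m m ℝ) :
    (A * Aᵀ).det = |A.det| ^ 2 := by
  rw [Matrix.det_mul, Matrix.det_transpose, sq_abs, sq]

theorem scaleKernel_nonneg (n : ℝ) {m : Type*} [Fintype m] [DecidableEq m]
    (S A : Matrix m m ℝ) : 0 ≤ scaleKernel n S A := by
  rw [scaleKernel, det_mul_transpose_self]
  positivity

theorem measurable_scaleKernel (n : ℝ) {α m : Type*} [MeasurableSpace α] [Fintype m]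
    [DecidableEq m] {S A : α → Matrix m m ℝ} (hS : ∀ i j, Measurable fun x => S x i j)
    (hA : ∀ i j, Measurable fun x => A x i j) :
    Measurable fun x => scaleKernel n (S x) (A x) := by
  have h1 := measurable_matrix_mul hA (G := fun x => (A x)ᵀ) fun i j => hA j i
  have h2 := measurable_matrix_mul (measurable_nonsing_inv h1) hS
  have h3 : Measurable fun x => ((A x * (A x)ᵀ)⁻¹ * S x).trace :=
    Finset.measurable_sum _ fun i _ => h2 i i
  exact ((measurable_det h1).pow_const _).mul (Real.measurable_exp.comp (h3.const_mul _))

/-- The normalizing constant of the scale matrix. -/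
noncomputable def scaleConst (m : Type*) [Fintype m] [DecidableEq m] (n : ℝ) : ℝ≥0∞ :=
  ∫⁻ A : m → m → ℝ, ENNReal.ofReal (scaleKernel n 1 (Matrix.of A))

/-- Substituting `A ↦ L A` with `S = L Lᵀ` gives `|det L|^q` from Lebesgue measure and `|det
L|^(-(n+q))` from the kernel, together `(det S)^(-n/2)`. -/
theorem lintegral_scaleKernel {m : Type*} [Fintype m] [DecidableEq m] (n : ℝ)
    {S : Matrix m m ℝ} (hS : S.PosDef) :
    ∫⁻ A : m → m → ℝ, ENNReal.ofReal (scaleKernel n S (Matrix.of A))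
      = ENNReal.ofReal (S.det ^ (-n / 2)) * scaleConst m n := by
  obtain ⟨L, rfl, hL⟩ := exists_mul_transpose_eq hS
  have hLp : 0 < |L.det| := abs_pos.2 hL
  refine (lintegral_leftRightMul hL (R := 1) (by simp) (fun A : Matrix m m ℝ =>
    ENNReal.ofReal (scaleKernel n (L * Lᵀ) A))).trans ?_
  have h1 : ∀ A : Matrix m m ℝ, ENNReal.ofReal (scaleKernel n (L * Lᵀ) (L * A * 1))
      = ENNReal.ofReal ((|L.det| ^ 2) ^ (-(n + Fintype.card m) / 2))
        * ENNReal.ofReal (scaleKernel n 1 A) := by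
    intro A
    have hLu : IsUnit L.det := hL.isUnit
    have hLtu : IsUnit Lᵀ.det := by rwa [Matrix.det_transpose]
    have h2 : ((L * A * (L * A)ᵀ)⁻¹ * (L * Lᵀ)).trace = ((A * Aᵀ)⁻¹ * 1).trace := by
      have h3 : (L * A * (L * A)ᵀ)⁻¹ * (L * Lᵀ) = Lᵀ⁻¹ * ((A * Aᵀ)⁻¹ * Lᵀ) := by
        have : L * A * (L * A)ᵀ = L * ((A * Aᵀ) * Lᵀ) := by
          rw [Matrix.transpose_mul]; simp only [Matrix.mul_assoc]
        rw [this, Matrix.mul_inv_rev, Matrix.mul_inv_rev]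
        simp only [Matrix.mul_assoc]
        rw [Matrix.nonsing_inv_mul_cancel_left _ _ hLu]
      rw [h3, Matrix.trace_mul_comm, Matrix.mul_assoc, Matrix.mul_nonsing_inv _ hLtu]
    rw [Matrix.mul_one, scaleKernel, h2, det_mul_transpose_self, Matrix.det_mul, abs_mul, mul_pow,
      Real.mul_rpow (by positivity) (by positivity), ← det_mul_transpose_self A, mul_assoc,
      ← scaleKernel, ENNReal.ofReal_mul (by positivity)]
  simp_rw [h1]
  rw [lintegral_const_mul' _ _ ENNReal.ofReal_ne_top, ← mul_assoc,
    ← ENNReal.ofReal_mul (by positivity), ← scaleConst, det_mul_transpose_self]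
  congr 2
  rw [Matrix.det_one, abs_one, one_pow, mul_one, ← Real.rpow_natCast, ← Real.rpow_natCast,
    ← Real.rpow_mul hLp.le, ← Real.rpow_mul hLp.le, ← Real.rpow_add hLp]
  congr 1
  push_cast
  ring

theorem isOpen_setOf_det_ne_zero (m : Type*) [Fintype m] [DecidableEq m] :
    IsOpen {A : m → m → ℝ | (Matrix.of A).det ≠ 0} := by
  have : Continuous fun A : m → m → ℝ => (Matrix.of A).det := by
    simp only [Matrix.det_apply, Matrix.of_apply]
    fun_prop
  exact isOpen_ne_fun this continuous_const

/-- A real power of 0 with nonzero exponent is 0. Singular `A` can thus be discarded without showing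
that they form a null set. -/
theorem scaleKernel_eq_zero {m : Type*} [Fintype m] [DecidableEq m] {n : ℝ}
    (hn : 0 < n) (S : Matrix m m ℝ) {A : Matrix m m ℝ} (hA : A.det = 0) :
    scaleKernel n S A = 0 := by
  have : -(n + Fintype.card m) / 2 ≠ 0 := by
    have : (0 : ℝ) ≤ Fintype.card m := Nat.cast_nonneg _
    rw [neg_div]
    exact neg_ne_zero.2 (by positivity)
  rw [scaleKernel, det_mul_transpose_self, hA, abs_zero, zero_pow two_ne_zero,
    Real.zero_rpow this, zero_mul]

theorem scaleConst_pos (m : Type*) [Fintype m] [DecidableEq m] (n : ℝ) : 0 < scaleConst m n := by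
  rw [scaleConst, lintegral_pos_iff_support]
  · refine lt_of_lt_of_le ((isOpen_setOf_det_ne_zero m).measure_pos volume
      ⟨Matrix.of.symm 1, by simp⟩) (measure_mono fun A hA => ?_)
    have : 0 < |(Matrix.of A).det| := abs_pos.2 hA
    simp only [Function.mem_support, ne_eq, ENNReal.ofReal_eq_zero, not_le]
    rw [scaleKernel, det_mul_transpose_self]
    positivity
  · exact ENNReal.measurable_ofReal.comp
      (measurable_scaleKernel n (fun _ _ => measurable_const) fun i j => by
        simp only [Matrix.of_apply]; fun_prop)

/-- The determinant grows polynomially, so half of the Gaussian decay absorbs its powers. -/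
theorem abs_det_pow_mul_exp_le (m : Type*) [Fintype m] [DecidableEq m] (d : ℕ) :
    ∃ C : ℝ, 0 ≤ C ∧ ∀ A : Matrix m m ℝ,
      |A.det| ^ d * Real.exp (-(1 / 2) * ∑ i, ∑ j, A i j ^ 2)
        ≤ C * Real.exp (-(1 / 4) * ∑ i, ∑ j, A i j ^ 2) := by
  set k := Fintype.card m * d with hk
  refine ⟨((Fintype.card m).factorial : ℝ) ^ d * (4 ^ k * k.factorial * Real.exp (1 / 4)),
    by positivity, fun A => ?_⟩
  set r := ∑ i, ∑ j, A i j ^ 2 with hr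
  have hr0 : 0 ≤ r := Finset.sum_nonneg fun _ _ => Finset.sum_nonneg fun _ _ => sq_nonneg _
  have hle : ∀ i j, |A i j| ≤ 1 + r := by
    intro i j
    have h1 : A i j ^ 2 ≤ r :=
      (Finset.single_le_sum (f := fun j => A i j ^ 2) (fun _ _ => sq_nonneg _)
        (Finset.mem_univ j)).trans
      (Finset.single_le_sum (f := fun i => ∑ j, A i j ^ 2)
        (fun _ _ => Finset.sum_nonneg fun _ _ => sq_nonneg _) (Finset.mem_univ i))
    nlinarith [sq_abs (A i j), sq_nonneg (|A i j| - 1)]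
  have hdet : |A.det| ≤ (Fintype.card m).factorial * (1 + r) ^ Fintype.card m := by
    have := Matrix.det_le (A := A) (abv := AbsoluteValue.abs) hle
    rwa [nsmul_eq_mul] at this
  -- From `y^k / k! ≤ exp y` at `y = (1 + r)/4`, which costs exactly a quarter of `r` in the
  -- exponent.
  have hpow : (1 + r) ^ k ≤ 4 ^ k * k.factorial * Real.exp ((1 + r) / 4) := by
    have := Real.pow_div_factorial_le_exp ((1 + r) / 4) (by positivity) k
    rw [div_le_iff₀ (by positivity), div_pow, div_le_iff₀ (by positivity)] at this
    linarith
  calc |A.det| ^ d * Real.exp (-(1 / 2) * r)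
      ≤ ((Fintype.card m).factorial * (1 + r) ^ Fintype.card m) ^ d
          * Real.exp (-(1 / 2) * r) := by gcongr
    _ = ((Fintype.card m).factorial : ℝ) ^ d * (1 + r) ^ k * Real.exp (-(1 / 2) * r) := by
        rw [mul_pow, ← pow_mul]
    _ ≤ ((Fintype.card m).factorial : ℝ) ^ d
          * (4 ^ k * k.factorial * Real.exp ((1 + r) / 4)) * Real.exp (-(1 / 2) * r) := by gcongr
    _ = _ := by
        have : Real.exp ((1 + r) / 4) * Real.exp (-(1 / 2) * r)
            = Real.exp (1 / 4) * Real.exp (-(1 / 4) * r) := by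
          rw [← Real.exp_add, ← Real.exp_add]
          ring_nf
        linear_combination ((Fintype.card m).factorial : ℝ) ^ d * (4 ^ k * k.factorial) * this

theorem integrable_exp_neg_quarter_sum_sq (m r : Type*) [Fintype m] [Fintype r] :
    Integrable fun A : m → r → ℝ => Real.exp (-(1 / 4) * ∑ i, ∑ j, A i j ^ 2) := by
  have h0 : Integrable fun x : ℝ => Real.exp (-(1 / 4) * x ^ 2) :=
    integrable_exp_neg_mul_sq (by norm_num)
  have h1 : Integrable fun v : r → ℝ => ∏ j, Real.exp (-(1 / 4) * v j ^ 2) :=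
    Integrable.fintype_prod fun _ => h0
  have h2 : Integrable fun A : m → r → ℝ => ∏ i, ∏ j, Real.exp (-(1 / 4) * A i j ^ 2) :=
    Integrable.fintype_prod (f := fun _ (v : r → ℝ) => ∏ j, Real.exp (-(1 / 4) * v j ^ 2))
      fun _ => h1
  refine h2.congr (Filter.Eventually.of_forall fun A => ?_)
  simp only [← Real.exp_sum, Finset.mul_sum]

/-- Inversion is an involution of the invertible matrices. It moves the singularity of the kernel at
singular matrices to infinity, where Gaussian decay controls it. -/
theorem scaleConst_lt_top (m : Type*) [Fintype m] [DecidableEq m] {n : ℕ} (hn : 0 < n)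
    (hmn : Fintype.card m ≤ n) : scaleConst m n < ⊤ := by
  set s := {A : m → m → ℝ | (Matrix.of A).det ≠ 0} with hs
  have hsm : MeasurableSet s := (isOpen_setOf_det_ne_zero m).measurableSet
  set f : (m → m → ℝ) → (m → m → ℝ) := fun B => Matrix.of.symm (Matrix.of B)⁻¹ with hf
  have hfs : ∀ A ∈ s, f A ∈ s := by
    intro A hA
    change (Matrix.of A)⁻¹.det ≠ 0
    rw [Matrix.det_nonsing_inv, Ring.inverse_eq_inv']
    exact inv_ne_zero hA
  have hff : ∀ A ∈ s, f (f A) = A := by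
    intro A hA
    have : (Matrix.of A)⁻¹⁻¹ = Matrix.of A := Matrix.nonsing_inv_nonsing_inv _ (IsUnit.mk0 _ hA)
    exact congrArg Matrix.of.symm this
  have himg : f '' s = s :=
    Set.Subset.antisymm (Set.image_subset_iff.2 hfs) fun A hA => ⟨f A, hfs A hA, hff A hA⟩
  have hinj : Set.InjOn f s := fun A hA B hB h => by rw [← hff A hA, h, hff B hB]
  have h1 : scaleConst m n
      = ∫⁻ A in s, ENNReal.ofReal (scaleKernel n 1 (Matrix.of A)) := by
    rw [scaleConst, ← lintegral_indicator hsm]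
    refine lintegral_congr fun A => ?_
    by_cases hA : A ∈ s
    · rw [Set.indicator_of_mem hA]
    · rw [Set.indicator_of_notMem hA, scaleKernel_eq_zero (by exact_mod_cast hn) _
        (not_not.1 hA), ENNReal.ofReal_zero]
  -- With q the size of `m`, inversion turns the kernel's power into `|det A|^(n+q)` and has
  -- Jacobian `|det A|^(-2q)`. The product is `|det A|^d` with `d = n - q`, a natural power since q
  -- ≤ n.
  obtain ⟨d, rfl⟩ := Nat.exists_eq_add_of_le hmn
  obtain ⟨C, hC, hbound⟩ := abs_det_pow_mul_exp_le m d
  have h2 := lintegral_image_eq_lintegral_abs_det_fderiv_mul volume hsm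
    (fun A hA => (hasFDerivAt_nonsing_inv hA).hasFDerivWithinAt) hinj
    (fun A => ENNReal.ofReal (scaleKernel ((Fintype.card m + d : ℕ) : ℝ) 1 (Matrix.of A)))
  rw [himg] at h2
  rw [h1, h2]
  have h3 : ∀ A ∈ s, ENNReal.ofReal |(LinearMap.toContinuousLinearMap
        (leftRightMul (-(Matrix.of A)⁻¹) (Matrix.of A)⁻¹)).det|
      * ENNReal.ofReal (scaleKernel ((Fintype.card m + d : ℕ) : ℝ) 1 (Matrix.of (f A)))
      ≤ ENNReal.ofReal (C * Real.exp (-(1 / 4) * ∑ i, ∑ j, A i j ^ 2)) := by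
    intro A hA
    rw [← ENNReal.ofReal_mul (abs_nonneg _)]
    refine ENNReal.ofReal_le_ofReal (le_trans (le_of_eq ?_) (hbound (Matrix.of A)))
    have hA0 : 0 < |(Matrix.of A).det| := abs_pos.2 hA
    have hAu : IsUnit (Matrix.of A).det := IsUnit.mk0 _ hA
    have e1 : |(LinearMap.toContinuousLinearMap
        (leftRightMul (-(Matrix.of A)⁻¹) (Matrix.of A)⁻¹)).det|
        = |(Matrix.of A).det| ^ (-(2 * (Fintype.card m : ℝ))) := by
      rw [LinearMap.det_toContinuousLinearMap, det_leftRightMul, Matrix.det_neg,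
        Matrix.det_nonsing_inv, Ring.inverse_eq_inv', abs_mul, abs_pow, abs_pow, abs_mul, abs_pow,
        abs_neg, abs_one, one_pow, one_mul, ← pow_add, abs_inv, inv_pow, ← Real.rpow_natCast,
        Real.rpow_neg hA0.le]
      push_cast
      ring_nf
    have e2 : (Matrix.of (f A)) = (Matrix.of A)⁻¹ := rfl
    have e3 : (((Matrix.of A)⁻¹ * ((Matrix.of A)⁻¹)ᵀ)⁻¹ * 1).trace = ∑ i, ∑ j, A i j ^ 2 := by
      rw [Matrix.mul_one, Matrix.mul_inv_rev, ← Matrix.transpose_nonsing_inv,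
        Matrix.nonsing_inv_nonsing_inv _ hAu, Finset.sum_comm]
      simp [Matrix.trace, Matrix.mul_apply, sq]
    rw [e1, e2, scaleKernel, e3, det_mul_transpose_self, Matrix.det_nonsing_inv,
      Ring.inverse_eq_inv', abs_inv, ← mul_assoc, ← Real.rpow_natCast (|(Matrix.of A).det|⁻¹),
      ← Real.rpow_mul (by positivity), Real.inv_rpow hA0.le, ← Real.rpow_neg hA0.le,
      ← Real.rpow_add hA0, ← Real.rpow_natCast |(Matrix.of A).det|]
    congr 2
    push_cast
    ring
  refine (setLIntegral_mono_ae' hsm (Filter.Eventually.of_forall h3)).trans_lt ?_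
  exact (setLIntegral_le_lintegral _ _).trans_lt
    ((integrable_exp_neg_quarter_sum_sq m m).const_mul C).lintegral_lt_top

end Scale
/-! ### The marginal mass -/

section Marginal

/-- The residual cross product matrix splits into the residual matrix and the deviation of the
coefficients from the least squares estimator. -/
theorem sub_mul_designRows_mul_transpose {n p q : ℕ} {X : Matrix (Fin p) (Fin n) ℝ}
    (Y : Matrix (Fin q) (Fin n) ℝ) {M : Finset (Fin p)} (hG : (gram X M).det ≠ 0)
    (B : Matrix (Fin q) M ℝ) :
    (Y - B * designRows X M) * (Y - B * designRows X M)ᵀ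
      = sigmaHat X Y M
        + (B - lsEstimator X Y M) * gram X M * (B - lsEstimator X Y M)ᵀ := by
  set D := B - lsEstimator X Y M with hD
  have h1 : lsEstimator X Y M * designRows X M = Y * hatMatrix X M := by
    simp only [lsEstimator, hatMatrix, Matrix.mul_assoc]
  have h2 : Y - B * designRows X M = Y * (1 - hatMatrix X M) - D * designRows X M := by
    rw [hD, Matrix.sub_mul, h1, Matrix.mul_sub, Matrix.mul_one]
    abel
  have h3 : (Y * (1 - hatMatrix X M)) * (D * designRows X M)ᵀ = 0 := by
    rw [Matrix.transpose_mul, ← Matrix.mul_assoc, Matrix.mul_assoc Y, Matrix.sub_mul,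
      Matrix.one_mul, hatMatrix_mul_transpose hG, sub_self, Matrix.mul_zero, Matrix.zero_mul]
  have h4 : (D * designRows X M) * (Y * (1 - hatMatrix X M))ᵀ = 0 := by
    have := congrArg Matrix.transpose h3
    rwa [Matrix.transpose_mul, Matrix.transpose_transpose, Matrix.transpose_zero] at this
  rw [h2, Matrix.transpose_sub, Matrix.sub_mul, Matrix.mul_sub (Y * (1 - hatMatrix X M)),
    Matrix.mul_sub (D * designRows X M), h3, h4,
    ← sigmaHat_eq_mul_transpose Y hG, sub_zero, zero_sub, sub_neg_eq_add, Matrix.transpose_mul D,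
    gram]
  simp only [Matrix.mul_assoc]

theorem posDef_sub_mul_designRows_mul_transpose {n p q : ℕ} {X : Matrix (Fin p) (Fin n) ℝ}
    {Y : Matrix (Fin q) (Fin n) ℝ} {M : Finset (Fin p)} (hG : (gram X M).det ≠ 0)
    (hS : (sigmaHat X Y M).det ≠ 0) (B : Matrix (Fin q) M ℝ) :
    ((Y - B * designRows X M) * (Y - B * designRows X M)ᵀ).PosDef := by
  rw [sub_mul_designRows_mul_transpose Y hG]
  refine (sigmaHat_posDef hG hS).add_posSemidef ?_
  have := (gram_posSemidef X M).mul_mul_conjTranspose_same (B - lsEstimator X Y M)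
  rwa [Matrix.conjTranspose_eq_transpose_of_trivial] at this

/-- The residual matrix is factored out of the Pythagorean decomposition. The double inverse matches
the column scale `(X_M X_Mᵀ)⁻¹` of the t-law. -/
theorem det_sub_mul_designRows_mul_transpose {n p q : ℕ} {X : Matrix (Fin p) (Fin n) ℝ}
    {Y : Matrix (Fin q) (Fin n) ℝ} {M : Finset (Fin p)} (hG : (gram X M).det ≠ 0)
    (hS : (sigmaHat X Y M).det ≠ 0) (B : Matrix (Fin q) M ℝ) :
    ((Y - B * designRows X M) * (Y - B * designRows X M)ᵀ).det
      = (sigmaHat X Y M).det * (1 + (sigmaHat X Y M)⁻¹ * (B - lsEstimator X Y M)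
          * ((gram X M)⁻¹)⁻¹ * (B - lsEstimator X Y M)ᵀ).det := by
  rw [sub_mul_designRows_mul_transpose Y hG, ← Matrix.det_mul, Matrix.mul_add, Matrix.mul_one,
    Matrix.nonsing_inv_nonsing_inv _ hG.isUnit]
  simp only [Matrix.mul_assoc]
  rw [Matrix.mul_nonsing_inv_cancel_left _ _ hS.isUnit]

/-- Isolates the dependence on `A`: the likelihood supplies the exponent -n/2 of `det AAᵀ`, the
Jacobian supplies -q/2. -/
theorem gfDensity_eq {n p q : ℕ} (hn : 0 < n) (ε : ℝ) {X : Matrix (Fin p) (Fin n) ℝ}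
    (Y : Matrix (Fin q) (Fin n) ℝ) {M : Finset (Fin p)} (hG : (gram X M).det ≠ 0)
    (B : Fin q → M → ℝ) (A : Fin q → Fin q → ℝ) :
    gfDensity ε X Y M (B, A) =
      ((2 * Real.pi) ^ (-((q : ℝ) * n) / 2)
        * ((gram X M).det ^ ((q : ℝ) / 2) * (sigmaHat X Y M).det ^ ((q : ℝ) / 2))
        * hEps ε X Y M (Matrix.of B))
      * scaleKernel n ((Y - Matrix.of B * designRows X M) * (Y - Matrix.of B * designRows X M)ᵀ)
          (Matrix.of A) := by
  have hn' : (0 : ℝ) < n := by exact_mod_cast hn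
  have hl : likelihood X Y M (Matrix.of B, Matrix.of A)
      = (2 * Real.pi) ^ (-((q : ℝ) * n) / 2) * (Matrix.of A * (Matrix.of A)ᵀ).det ^ (-(n : ℝ) / 2)
        * Real.exp (-(1 / 2) * ((Matrix.of A * (Matrix.of A)ᵀ)⁻¹
          * ((Y - Matrix.of B * designRows X M) * (Y - Matrix.of B * designRows X M)ᵀ)).trace) := by
    simp [likelihood, matrixNormalPDF, Matrix.mul_assoc]
  -- For singular `A` the closed form of the Jacobian is unavailable, but the determinant power in
  -- the likelihood is already 0.
  by_cases hA : (Matrix.of A).det = 0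
  · have h0 : (Matrix.of A * (Matrix.of A)ᵀ).det ^ (-(n : ℝ) / 2) = 0 := by
      rw [Matrix.det_mul, hA, zero_mul, Real.zero_rpow]
      rw [neg_div]
      exact neg_ne_zero.2 (by positivity)
    rw [scaleKernel_eq_zero hn' _ hA, gfDensity, hl, h0]
    simp
  · have hp : 0 < (Matrix.of A * (Matrix.of A)ᵀ).det := by
      have := abs_pos.2 hA
      rw [det_mul_transpose_self]
      positivity
    have h1 : (Matrix.of A * (Matrix.of A)ᵀ).det ^ (-((n : ℝ) + Fintype.card (Fin q)) / 2)
        = (Matrix.of A * (Matrix.of A)ᵀ).det ^ (-(n : ℝ) / 2)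
          * (Matrix.of A * (Matrix.of A)ᵀ).det ^ (-(q : ℝ) / 2) := by
      rw [← Real.rpow_add hp, Fintype.card_fin]
      ring_nf
    rw [gfDensity, hl, gfJacobian_eq Y _ hG hA, scaleKernel, h1]
    ring

theorem measurable_gfDensity {n p q : ℕ} (hn : 0 < n) (ε : ℝ) {X : Matrix (Fin p) (Fin n) ℝ}
    (Y : Matrix (Fin q) (Fin n) ℝ) {M : Finset (Fin p)} (hG : (gram X M).det ≠ 0) :
    Measurable (gfDensity ε X Y M) := by
  have h1 : gfDensity ε X Y M = fun θ => gfDensity ε X Y M (θ.1, θ.2) := rfl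
  rw [h1]
  simp_rw [gfDensity_eq hn ε Y hG]
  have hB : ∀ i j, Measurable fun θ : (Fin q → M → ℝ) × (Fin q → Fin q → ℝ) =>
      (Y - Matrix.of θ.1 * designRows X M) i j := by
    intro i j
    have h2 := measurable_matrix_mul (G := fun _ => designRows X M)
      (F := fun θ : (Fin q → M → ℝ) × (Fin q → Fin q → ℝ) => Matrix.of θ.1)
      (fun i j => by simp only [Matrix.of_apply]; fun_prop) (fun _ _ => measurable_const) i j
    exact measurable_const.sub h2
  have hA : ∀ i j, Measurable fun θ : (Fin q → M → ℝ) × (Fin q → Fin q → ℝ) =>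
      (Matrix.of θ.2) i j := by
    intro i j
    simp only [Matrix.of_apply]
    fun_prop
  have hS := measurable_matrix_mul hB
    (G := fun θ : (Fin q → M → ℝ) × (Fin q → Fin q → ℝ) =>
      (Y - Matrix.of θ.1 * designRows X M)ᵀ) fun i j => hB j i
  have hh : Measurable fun θ : (Fin q → M → ℝ) × (Fin q → Fin q → ℝ) =>
      hEps ε X Y M (Matrix.of θ.1) := (measurable_hEps ε X Y M).comp measurable_fst
  exact (hh.const_mul _).mul (measurable_scaleKernel n hS hA)

theorem gfDensity_nonneg {n p q : ℕ} (hn : 0 < n) (ε : ℝ) {X : Matrix (Fin p) (Fin n) ℝ}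
    (Y : Matrix (Fin q) (Fin n) ℝ) {M : Finset (Fin p)} (hG : (gram X M).det ≠ 0)
    (θ : (Fin q → M → ℝ) × (Fin q → Fin q → ℝ)) : 0 ≤ gfDensity ε X Y M θ := by
  have h1 : gfDensity ε X Y M θ = gfDensity ε X Y M (θ.1, θ.2) := rfl
  have h2 := hEps_nonneg ε X Y M (Matrix.of θ.1)
  have h3 := scaleKernel_nonneg n ((Y - Matrix.of θ.1 * designRows X M)
    * (Y - Matrix.of θ.1 * designRows X M)ᵀ) (Matrix.of θ.2)
  have h4 := (gram_posSemidef X M).det_nonneg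
  have h5 := (sigmaHat_posSemidef Y hG).det_nonneg
  rw [h1, gfDensity_eq hn ε Y hG]
  positivity

/-- The universal constant relating the marginal mass to its closed form. -/
noncomputable def massConst (n q : ℕ) : ℝ :=
  (2 * Real.pi) ^ (-((q : ℝ) * n) / 2) * (scaleConst (Fin q) n).toReal / multiGamma q (n / 2)

theorem massConst_pos {n q : ℕ} (hq : 1 ≤ q) (hqn : q ≤ n) : 0 < massConst n q := by
  have h1 : 0 < (scaleConst (Fin q) n).toReal :=
    ENNReal.toReal_pos (scaleConst_pos _ _).ne' (scaleConst_lt_top _ (by omega) (by simpa)).ne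
  have h2 : (q : ℝ) ≤ n := by exact_mod_cast hqn
  have h3 := multiGamma_pos (q := q) (a := n / 2) (by linarith)
  rw [massConst]
  positivity

/-- The factor of the closed form in front of the expectation. -/
noncomputable def massFactor {n p q : ℕ} (X : Matrix (Fin p) (Fin n) ℝ)
    (Y : Matrix (Fin q) (Fin n) ℝ) (M : Finset (Fin p)) : ℝ :=
  multiGamma q (((n : ℝ) - M.card) / 2) * Real.pi ^ ((q : ℝ) * M.card / 2)
    * (sigmaHat X Y M).det ^ (-((n : ℝ) - M.card - q) / 2)

theorem massFactor_pos {n p q : ℕ} {X : Matrix (Fin p) (Fin n) ℝ} {Y : Matrix (Fin q) (Fin n) ℝ}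
    {M : Finset (Fin p)} (hM : M.card + q < n) (hG : (gram X M).det ≠ 0)
    (hS : (sigmaHat X Y M).det ≠ 0) : 0 < massFactor X Y M := by
  have h1 : (M.card : ℝ) + q < n := by exact_mod_cast hM
  have h2 := multiGamma_pos (q := q) (a := ((n : ℝ) - M.card) / 2) (by linarith)
  have h3 := (sigmaHat_posDef hG hS).det_pos
  rw [massFactor]
  positivity

theorem det_one_add_pos {n p q : ℕ} {X : Matrix (Fin p) (Fin n) ℝ} {Y : Matrix (Fin q) (Fin n) ℝ}
    {M : Finset (Fin p)} (hG : (gram X M).det ≠ 0) (hS : (sigmaHat X Y M).det ≠ 0)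
    (B : Matrix (Fin q) M ℝ) :
    0 < (1 + (sigmaHat X Y M)⁻¹ * (B - lsEstimator X Y M)
          * ((gram X M)⁻¹)⁻¹ * (B - lsEstimator X Y M)ᵀ).det := by
  have h1 := (posDef_sub_mul_designRows_mul_transpose hG hS B).det_pos
  rw [det_sub_mul_designRows_mul_transpose hG hS] at h1
  exact pos_of_mul_pos_right h1 (sigmaHat_posDef hG hS).det_pos.le

/-- The density of the law of the coefficients. -/
noncomputable def coefPDF {n p q : ℕ} (X : Matrix (Fin p) (Fin n) ℝ) (Y : Matrix (Fin q) (Fin n) ℝ)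
    (M : Finset (Fin p)) (B : Matrix (Fin q) M ℝ) : ℝ :=
  matrixTPDF ((n : ℝ) - M.card - q + 1) (lsEstimator X Y M) (sigmaHat X Y M) (gram X M)⁻¹ B

theorem measurable_coefPDF {n p q : ℕ} (X : Matrix (Fin p) (Fin n) ℝ)
    (Y : Matrix (Fin q) (Fin n) ℝ) (M : Finset (Fin p)) :
    Measurable fun B : Fin q → M → ℝ => coefPDF X Y M (Matrix.of B) := by
  have hB : ∀ i j, Measurable fun B : Fin q → M → ℝ => (Matrix.of B - lsEstimator X Y M) i j := by
    intro i j
    simp only [Matrix.sub_apply, Matrix.of_apply]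
    fun_prop
  have h1 := measurable_matrix_mul
    (measurable_matrix_mul (measurable_matrix_mul
      (F := fun _ : Fin q → M → ℝ => (sigmaHat X Y M)⁻¹) (fun _ _ => measurable_const) hB)
      (G := fun _ => ((gram X M)⁻¹)⁻¹) fun _ _ => measurable_const)
    (G := fun B => (Matrix.of B - lsEstimator X Y M)ᵀ) fun i j => hB j i
  have h2 : Measurable fun B : Fin q → M → ℝ => (1 + (sigmaHat X Y M)⁻¹
      * (Matrix.of B - lsEstimator X Y M) * ((gram X M)⁻¹)⁻¹
        * (Matrix.of B - lsEstimator X Y M)ᵀ).det :=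
    measurable_det fun i j => measurable_const.add (h1 i j)
  exact (h2.pow_const _).const_mul _

/-- With ν = n - |M| - q + 1 one has ν + |M| + q - 1 = n and ν + q - 1 = n - |M|. Hence the
t-density has exponent -n/2, and its denominator cancels the gamma and π factors of `massFactor`. -/
theorem coef_mul_det_rpow_eq {n p q : ℕ} {X : Matrix (Fin p) (Fin n) ℝ}
    {Y : Matrix (Fin q) (Fin n) ℝ} {M : Finset (Fin p)} (hM : M.card + q < n)
    (hG : (gram X M).det ≠ 0) (hS : (sigmaHat X Y M).det ≠ 0) (B : Matrix (Fin q) M ℝ) :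
    (2 * Real.pi) ^ (-((q : ℝ) * n) / 2)
        * ((gram X M).det ^ ((q : ℝ) / 2) * (sigmaHat X Y M).det ^ ((q : ℝ) / 2))
        * ((Y - B * designRows X M) * (Y - B * designRows X M)ᵀ).det ^ (-(n : ℝ) / 2)
        * (scaleConst (Fin q) n).toReal
      = massConst n q * massFactor X Y M * coefPDF X Y M B := by
  have h1 : (M.card : ℝ) + q < n := by exact_mod_cast hM
  have hm : (0 : ℝ) ≤ M.card := Nat.cast_nonneg _
  have hΓ1 := multiGamma_pos (q := q) (a := ((n : ℝ) - M.card) / 2) (by linarith)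
  have hΓ2 := multiGamma_pos (q := q) (a := (n : ℝ) / 2) (by linarith)
  have hSp := (sigmaHat_posDef hG hS).det_pos
  have hGp := (gram_posDef hG).det_pos
  have hdp := det_one_add_pos hG hS B
  rw [massConst, massFactor, coefPDF, matrixTPDF, det_sub_mul_designRows_mul_transpose hG hS]
  simp only [Fintype.card_fin, Fintype.card_coe]
  have e1 : ((n : ℝ) - M.card - q + 1 + M.card + q - 1) / 2 = n / 2 := by ring
  have e2 : ((n : ℝ) - M.card - q + 1 + q - 1) / 2 = (n - M.card) / 2 := by ring
  have e3 : -((n : ℝ) - M.card - q + 1 + M.card + q - 1) / 2 = -(n : ℝ) / 2 := by ring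
  rw [e1, e2, e3]
  generalize (1 + (sigmaHat X Y M)⁻¹ * (B - lsEstimator X Y M)
          * ((gram X M)⁻¹)⁻¹ * (B - lsEstimator X Y M)ᵀ).det = d at *
  have e4 : (gram X M)⁻¹.det ^ (-(q : ℝ) / 2) = (gram X M).det ^ ((q : ℝ) / 2) := by
    rw [Matrix.det_nonsing_inv, Ring.inverse_eq_inv', Real.inv_rpow hGp.le, neg_div,
      Real.rpow_neg hGp.le, inv_inv]
  have e5 : (sigmaHat X Y M).det ^ (-((n : ℝ) - M.card - q) / 2)
      * (sigmaHat X Y M).det ^ (-(M.card : ℝ) / 2)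
      = (sigmaHat X Y M).det ^ ((q : ℝ) / 2) * (sigmaHat X Y M).det ^ (-(n : ℝ) / 2) := by
    rw [← Real.rpow_add hSp, ← Real.rpow_add hSp]
    ring_nf
  rw [e4, Real.mul_rpow hSp.le hdp.le]
  have hπ := Real.rpow_pos_of_pos Real.pi_pos ((q : ℝ) * M.card / 2)
  generalize multiGamma q (((n : ℝ) - M.card) / 2) = g1 at *
  generalize multiGamma q ((n : ℝ) / 2) = g2 at *
  generalize Real.pi ^ ((q : ℝ) * M.card / 2) = w at *
  generalize (2 * Real.pi) ^ (-((q : ℝ) * n) / 2) = t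
  generalize (gram X M).det ^ ((q : ℝ) / 2) = u
  generalize d ^ (-(n : ℝ) / 2) = v
  generalize (scaleConst (Fin q) n).toReal = k
  generalize (sigmaHat X Y M).det ^ (-((n : ℝ) - M.card - q) / 2) = s1 at *
  generalize (sigmaHat X Y M).det ^ (-(M.card : ℝ) / 2) = s2 at *
  generalize (sigmaHat X Y M).det ^ ((q : ℝ) / 2) = s3 at *
  generalize (sigmaHat X Y M).det ^ (-(n : ℝ) / 2) = s4 at *
  field_simp
  linear_combination (-(t * u * v * k)) * e5

theorem isProbabilityMeasure_coefLaw {n p q : ℕ} {X : Matrix (Fin p) (Fin n) ℝ}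
    {Y : Matrix (Fin q) (Fin n) ℝ} {M : Finset (Fin p)} (hM : M.card + q < n)
    (hG : (gram X M).det ≠ 0) (hS : (sigmaHat X Y M).det ≠ 0) :
    IsProbabilityMeasure (coefLaw X Y M) := by
  have h1 : (M.card : ℝ) + q < n := by exact_mod_cast hM
  exact isProbabilityMeasure_matrixT (by linarith) _ (sigmaHat_posDef hG hS) (gram_posDef hG).inv

/-- Tonelli with `A` innermost. Since the value is computed in `ℝ≥0∞`, its finiteness yields
integrability afterwards. -/
theorem lintegral_gfDensity {n p q : ℕ} (hq : 1 ≤ q) (ε : ℝ) {X : Matrix (Fin p) (Fin n) ℝ}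
    {Y : Matrix (Fin q) (Fin n) ℝ} {M : Finset (Fin p)} (hM : M.card + q < n)
    (hG : (gram X M).det ≠ 0) (hS : (sigmaHat X Y M).det ≠ 0) :
    ∫⁻ θ : (Fin q → M → ℝ) × (Fin q → Fin q → ℝ), ENNReal.ofReal (gfDensity ε X Y M θ)
      = ENNReal.ofReal (massConst n q * closedForm ε X Y M) := by
  have hn : 0 < n := by omega
  have hK : scaleConst (Fin q) n ≠ ⊤ := (scaleConst_lt_top _ hn (by simp; omega)).ne
  have hcf : 0 ≤ massConst n q * massFactor X Y M :=
    (mul_pos (massConst_pos hq (by omega)) (massFactor_pos hM hG hS)).le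
  have hGp := (gram_posDef hG).det_pos
  have hSp := (sigmaHat_posDef hG hS).det_pos
  have := isProbabilityMeasure_coefLaw hM hG hS
  have h1 : ∀ B : Fin q → M → ℝ,
      ∫⁻ A : Fin q → Fin q → ℝ, ENNReal.ofReal (gfDensity ε X Y M (B, A))
        = ENNReal.ofReal (massConst n q * massFactor X Y M)
          * (ENNReal.ofReal (coefPDF X Y M (Matrix.of B))
            * ENNReal.ofReal (hEps ε X Y M (Matrix.of B))) := by
    intro B
    have hh := hEps_nonneg ε X Y M (Matrix.of B)
    have hp := posDef_sub_mul_designRows_mul_transpose hG hS (Matrix.of B)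
    have hpd := hp.det_pos
    simp_rw [gfDensity_eq hn ε Y hG]
    simp_rw [ENNReal.ofReal_mul (p := (2 * Real.pi) ^ (-((q : ℝ) * n) / 2)
        * ((gram X M).det ^ ((q : ℝ) / 2) * (sigmaHat X Y M).det ^ ((q : ℝ) / 2))
        * hEps ε X Y M (Matrix.of B)) (by positivity)]
    rw [lintegral_const_mul' _ _ ENNReal.ofReal_ne_top, lintegral_scaleKernel _ hp,
      ← ENNReal.ofReal_toReal hK, ← ENNReal.ofReal_mul (by positivity),
      ← ENNReal.ofReal_mul (by positivity), ← ENNReal.ofReal_mul' hh, ← ENNReal.ofReal_mul hcf,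
      ← mul_assoc (massConst n q * massFactor X Y M), ← coef_mul_det_rpow_eq hM hG hS (Matrix.of B)]
    congr 1
    ring
  have hhm := measurable_hEps ε X Y M
  rw [Measure.volume_eq_prod, lintegral_prod _
    (measurable_gfDensity hn ε Y hG).ennreal_ofReal.aemeasurable]
  simp_rw [h1]
  rw [lintegral_const_mul' _ _ ENNReal.ofReal_ne_top]
  have h2 : ∫⁻ B : Fin q → M → ℝ, ENNReal.ofReal (coefPDF X Y M (Matrix.of B))
        * ENNReal.ofReal (hEps ε X Y M (Matrix.of B))
      = ∫⁻ B, ENNReal.ofReal (hEps ε X Y M (Matrix.of B)) ∂(coefLaw X Y M) :=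
    (lintegral_withDensity_eq_lintegral_mul volume
      (ENNReal.measurable_ofReal.comp (measurable_coefPDF X Y M))
      (ENNReal.measurable_ofReal.comp hhm)).symm
  have h3 : Integrable (fun B : Fin q → M → ℝ => hEps ε X Y M (Matrix.of B)) (coefLaw X Y M) :=
    Integrable.of_bound hhm.aestronglyMeasurable 1 (Filter.Eventually.of_forall fun B => by
      rw [Real.norm_of_nonneg (hEps_nonneg _ _ _ _ _)]
      exact hEps_le_one _ _ _ _ _)
  rw [h2, ← ofReal_integral_eq_lintegral_ofReal h3
    (Filter.Eventually.of_forall fun B => hEps_nonneg _ _ _ _ _), ← ENNReal.ofReal_mul hcf,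
    mul_assoc]
  rfl

theorem integrable_gfDensity {n p q : ℕ} (hq : 1 ≤ q) (ε : ℝ) {X : Matrix (Fin p) (Fin n) ℝ}
    {Y : Matrix (Fin q) (Fin n) ℝ} {M : Finset (Fin p)} (hM : M.card + q < n)
    (hG : (gram X M).det ≠ 0) (hS : (sigmaHat X Y M).det ≠ 0) :
    Integrable (gfDensity ε X Y M) volume := by
  have hn : 0 < n := by omega
  rw [← lintegral_ofReal_ne_top_iff_integrable
    (measurable_gfDensity hn ε Y hG).aestronglyMeasurable
    (Filter.Eventually.of_forall (gfDensity_nonneg hn ε Y hG)), lintegral_gfDensity hq ε hM hG hS]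
  exact ENNReal.ofReal_ne_top

theorem closedForm_nonneg {n p q : ℕ} (ε : ℝ) {X : Matrix (Fin p) (Fin n) ℝ}
    {Y : Matrix (Fin q) (Fin n) ℝ} {M : Finset (Fin p)} (hM : M.card + q < n)
    (hG : (gram X M).det ≠ 0) (hS : (sigmaHat X Y M).det ≠ 0) : 0 ≤ closedForm ε X Y M :=
  mul_nonneg (massFactor_pos hM hG hS).le (integral_nonneg fun _ => hEps_nonneg _ _ _ _ _)

theorem gfWeight_eq {n p q : ℕ} (hq : 1 ≤ q) (ε : ℝ) {X : Matrix (Fin p) (Fin n) ℝ}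
    {Y : Matrix (Fin q) (Fin n) ℝ} {M : Finset (Fin p)} (hM : M.card + q < n)
    (hG : (gram X M).det ≠ 0) (hS : (sigmaHat X Y M).det ≠ 0) :
    gfWeight ε X Y M = massConst n q * closedForm ε X Y M := by
  have hn : 0 < n := by omega
  rw [gfWeight, integral_eq_lintegral_of_nonneg_ae
    (Filter.Eventually.of_forall (gfDensity_nonneg hn ε Y hG))
    (measurable_gfDensity hn ε Y hG).aestronglyMeasurable, lintegral_gfDensity hq ε hM hG hS]
  exact ENNReal.toReal_ofReal (mul_nonneg (massConst_pos hq (by omega)).le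
    (closedForm_nonneg ε hM hG hS))

theorem gfDensity_eq_zero {n p q : ℕ} {ε : ℝ} {X : Matrix (Fin p) (Fin n) ℝ}
    {Y : Matrix (Fin q) (Fin n) ℝ} {M : Finset (Fin p)}
    (h : ∀ B : Matrix (Fin q) M ℝ, hEps ε X Y M B = 0) : gfDensity ε X Y M = 0 := by
  funext θ
  rw [gfDensity, h, mul_zero, Pi.zero_apply]

theorem closedForm_eq_zero {n p q : ℕ} {ε : ℝ} {X : Matrix (Fin p) (Fin n) ℝ}
    {Y : Matrix (Fin q) (Fin n) ℝ} {M : Finset (Fin p)}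
    (h : ∀ B : Matrix (Fin q) M ℝ, hEps ε X Y M B = 0) : closedForm ε X Y M = 0 := by
  simp [closedForm, h]

end Marginal
end EAS

/-! ### The three assertions assembled -/

theorem mainTheorem6 (n q : ℕ) (hq : 1 ≤ q) :
    (∀ (p : ℕ) (X : Matrix (Fin p) (Fin n) ℝ) (Y : Matrix (Fin q) (Fin n) ℝ)
        (M : Finset (Fin p)) (B : Matrix (Fin q) M ℝ) (A : Matrix (Fin q) (Fin q) ℝ),
        (EAS.gram X M).det ≠ 0 → A.det ≠ 0 →
          EAS.gfJacobian X Y M (B, A) =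
            (A * Aᵀ).det ^ (-(q : ℝ) / 2) * (EAS.gram X M).det ^ ((q : ℝ) / 2)
              * (EAS.sigmaHat X Y M).det ^ ((q : ℝ) / 2)) ∧
    ∃ c : ℝ, 0 < c ∧
      ∀ (p : ℕ) (X : Matrix (Fin p) (Fin n) ℝ) (Y : Matrix (Fin q) (Fin n) ℝ) (ε : ℝ), 0 < ε →
        (∀ M : Finset (Fin p), EAS.Nondegenerate X Y M →
          (M.card + q < n → (EAS.gram X M).det ≠ 0 →
            IsProbabilityMeasure (EAS.coefLaw X Y M)) ∧
          ((M.card + q < n → (EAS.gram X M).det = 0) →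
            ∀ B : Matrix (Fin q) M ℝ, EAS.hEps ε X Y M B = 0) ∧
          Integrable (EAS.gfDensity ε X Y M) volume ∧
          EAS.gfWeight ε X Y M = c * EAS.closedForm ε X Y M) ∧
        (∀ K : Finset (Finset (Fin p)), (∀ M ∈ K, EAS.Nondegenerate X Y M) →
          ∀ M ∈ K, EAS.gfMass ε X Y K M =
            EAS.closedForm ε X Y M / ∑ M' ∈ K, EAS.closedForm ε X Y M') := by
  refine ⟨fun p X Y M B A hG hA => EAS.gfJacobian_eq Y B hG hA, ?_⟩
  -- If n ≤ q, no model satisfies |M| + q < n, every mass is 0, and any positive constant serves.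
  obtain ⟨c, hc, hc'⟩ : ∃ c : ℝ, 0 < c ∧ (q < n → c = EAS.massConst n q) := by
    by_cases h : q < n
    · exact ⟨_, EAS.massConst_pos hq h.le, fun _ => rfl⟩
    · exact ⟨1, one_pos, fun h' => absurd h' h⟩
  refine ⟨c, hc, fun p X Y ε hε => ?_⟩
  have hmass : ∀ M : Finset (Fin p), EAS.Nondegenerate X Y M →
      Integrable (EAS.gfDensity ε X Y M) volume ∧
      EAS.gfWeight ε X Y M = c * EAS.closedForm ε X Y M := by
    intro M hY
    -- Outside the regular case the admissibility function is identically 0, so density, mass and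
    -- closed form all vanish.
    by_cases h : M.card + q < n ∧ (EAS.gram X M).det ≠ 0
    · rw [hc' (by omega)]
      exact ⟨EAS.integrable_gfDensity hq ε h.1 h.2 (hY h.1 h.2),
        EAS.gfWeight_eq hq ε h.1 h.2 (hY h.1 h.2)⟩
    · have h0 := EAS.hEps_eq_zero_of_gram_det_eq_zero hε Y (X := X) (M := M)
        fun h1 => by_contra fun h2 => h ⟨h1, h2⟩
      rw [EAS.gfWeight, EAS.gfDensity_eq_zero h0, EAS.closedForm_eq_zero h0]
      exact ⟨integrable_zero _ _ _, by simp⟩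
  refine ⟨fun M hY => ⟨fun hM hG => EAS.isProbabilityMeasure_coefLaw hM hG (hY hM hG),
    EAS.hEps_eq_zero_of_gram_det_eq_zero hε Y, hmass M hY⟩, fun K hK M hM => ?_⟩
  -- The nonzero constant cancels from the quotient even when the sum is 0, both sides then being 0
  -- by the convention for division.
  rw [EAS.gfMass, (hmass M (hK M hM)).2,
    Finset.sum_congr rfl fun M' hM' => (hmass M' (hK M' hM')).2, ← Finset.mul_sum,
    mul_div_mul_left _ _ hc.ne']
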